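/- Let $(W,S)$ be any Coxeter system, with length function $w\mapsto|w|$ and Bruhat order $\le$. Let $H$ be the generic Iwahori–Hecke algebra over $\mathcal A=\mathbb Z[q^{1/2},q^{-1/2}]$, with generators $T_r$ ($r\in S$) subject to the braid relations of $W$ and the quadratic relations $(T_r+1)(T_r-q)=0$; for $w\in W$ put $T_w=T_{r_1}\cdots T_{r_n}$ for a reduced expression $w=r_1\cdots r_n$. Let $\overline{\phantom{x}}$ be the ring involution of $\mathcal A$ with $q^{1/2}\mapsto q^{-1/2}$, and also the ring involution of $H$ extending it with $\overline{T_r}=T_r^{-1}$. The Kazhdan–Lusztig polynomials $P_{y,w}\in\mathbb Z[q]$ and the elements $C_w\in H$ are determined by: $P_{w,w}=1$; $\deg P_{y,w}\le(|w|-|y|-1)/2$ for $y<w$; $P_{y,w}=0$ unless $y\le w$; and the element $$C_w=\sum_{y\le w}(-1)^{|y|+|w|}q^{|w|/2-|y|}\,\overline{P_{y,w}}\,T_y$$ satisfies $\overline{C_w}=C_w$. Put $C'_w=\sum_{y\le w}q^{-|w|/2}P_{y,w}T_y$. The polynomials $R_{y,w}\in\mathbb Z[q]$ are determined by $(T_{w^{-1}})^{-1}=\sum_{y\le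 w}\overline{R_{y,w}}\,q^{-|y|}T_y$ (and $R_{y,w}=0$ unless $y\le w$), and the inverse Kazhdan–Lusztig polynomials $Q_{y,w}\in\mathbb Z[q]$ by $\sum_{y\le z\le w}(-1)^{|y|+|z|}Q_{y,z}P_{z,w}=\delta_{y,w}$ for $y\le w$ (and $Q_{y,w}=0$ unless $y\le w$). For $y\le x$ put $$\Xi_{y,x}=\sum_{y\le y'\le x'\le x}Q_{y,y'}R_{y',x'}P_{x',x}\in\mathbb Z[q].$$ Then $(C_w)_{w\in W}$ and $(C'_w)_{w\in W}$ are $\mathcal A$-bases of $H$, and for every $x\in W$ the set $\{y\in W: y\le x\}$ is finite and $$C'_x=\sum_{y\le x}q^{(|y|-|x|)/2}\,\Xi_{y,x}\,C_y .$$ Thus $\Xi$ gives the transition matrix between the two Kazhdan–Lusztig bases. -/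

import Mathlib

open Polynomial

noncomputable section

namespace KazhdanLusztig

/-- The ring `ℤ[q^{1/2}, q^{-1/2}]` of Laurent polynomials in the indeterminate `q^{1/2}`. -/
abbrev A : Type := LaurentPolynomial ℤ

/-- `qHalf n` is `q^{n/2}`. In particular `qHalf 2` is `q`. -/
def qHalf (n : ℤ) : A := LaurentPolynomial.T n

/-- The inclusion `ℤ[q] → ℤ[q^{1/2}, q^{-1/2}]`. -/
def incl : ℤ[X] →+* A := (Polynomial.aeval (qHalf 2) : ℤ[X] →ₐ[ℤ] A).toRingHom

/-- The ring involution of `ℤ[q^{1/2}, q^{-1/2}]` with `q^{1/2} ↦ q^{-1/2}`. -/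
def barA : A →+* A := (LaurentPolynomial.invert : A ≃ₐ[ℤ] A).toAlgHom.toRingHom

theorem barA_qHalf (n : ℤ) : barA (qHalf n) = qHalf (-n) := by
  simp [barA, qHalf]

theorem qHalf_mul (m n : ℤ) : qHalf m * qHalf n = qHalf (m + n) :=
  (LaurentPolynomial.T_add m n).symm

theorem qHalf_zero : qHalf 0 = 1 := LaurentPolynomial.T_zero

variable {B : Type*}

/-- The defining relations of the generic Iwahori–Hecke algebra: the quadratic relations
`(T_i + 1)(T_i - q) = 0` and the braid relations `⋯ T_i T_j = ⋯ T_j T_i` with `M i j` factors on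
each side. (`M i j = 0` stands for `∞`; then both words are empty and no relation is imposed.) -/
inductive HeckeRel (M : CoxeterMatrix B) : FreeAlgebra A B → FreeAlgebra A B → Prop
  | quadratic (i : B) :
      HeckeRel M
        ((FreeAlgebra.ι A i + 1) * (FreeAlgebra.ι A i - algebraMap A (FreeAlgebra A B) (qHalf 2))) 0
  | braid (i j : B) :
      HeckeRel M
        ((CoxeterSystem.braidWord M i j).map (FreeAlgebra.ι A)).prod
        ((CoxeterSystem.braidWord M j i).map (FreeAlgebra.ι A)).prod

/-- The generic Iwahori–Hecke algebra over `ℤ[q^{1/2}, q^{-1/2}]`, by generators and relations. -/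
def Hecke (M : CoxeterMatrix B) : Type _ := RingQuot (HeckeRel M)

instance (M : CoxeterMatrix B) : Ring (Hecke M) :=
  inferInstanceAs (Ring (RingQuot (HeckeRel M)))

instance (M : CoxeterMatrix B) : Algebra A (Hecke M) :=
  inferInstanceAs (Algebra A (RingQuot (HeckeRel M)))

section Generators

variable (M : CoxeterMatrix B)

/-- The projection from the free algebra to the Hecke algebra. -/
def mk : FreeAlgebra A B →ₐ[A] Hecke M := RingQuot.mkAlgHom A (HeckeRel M)

theorem mk_rel {x y : FreeAlgebra A B} (h : HeckeRel M x y) : mk M x = mk M y :=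
  RingQuot.mkAlgHom_rel A h

/-- The generator `T_i` of the Hecke algebra. -/
def gen (i : B) : Hecke M := mk M (FreeAlgebra.ι A i)

theorem gen_quadratic (i : B) :
    (gen M i + 1) * (gen M i - algebraMap A (Hecke M) (qHalf 2)) = 0 := by
  have h := mk_rel M (HeckeRel.quadratic (M := M) i)
  simpa [gen] using h

theorem gen_braid (i j : B) :
    ((CoxeterSystem.braidWord M i j).map (gen M)).prod =
      ((CoxeterSystem.braidWord M j i).map (gen M)).prod := by
  have h := mk_rel M (HeckeRel.braid (M := M) i j)
  rw [map_list_prod, map_list_prod, List.map_map, List.map_map] at h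
  exact h

/-- The inverse `q⁻¹ T_i + (q⁻¹ - 1)` of the generator `T_i`. -/
def genInv (i : B) : Hecke M := qHalf (-2) • gen M i + algebraMap A (Hecke M) (qHalf (-2) - 1)

theorem gen_sq (i : B) :
    gen M i * gen M i = qHalf 2 • gen M i - gen M i + algebraMap A (Hecke M) (qHalf 2) := by
  have h := gen_quadratic M i
  have hc : gen M i * algebraMap A (Hecke M) (qHalf 2) = qHalf 2 • gen M i := by
    rw [Algebra.smul_def, Algebra.commutes]
  rw [add_mul, mul_sub, one_mul, hc] at h
  rw [← sub_eq_zero, ← h]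
  abel

theorem gen_mul_genInv (i : B) : gen M i * genInv M i = 1 := by
  have e : qHalf (-2) * qHalf 2 = 1 := by rw [qHalf_mul]; exact qHalf_zero
  have hc : gen M i * algebraMap A (Hecke M) (qHalf (-2) - 1) =
      (qHalf (-2) - 1) • gen M i := by
    rw [Algebra.smul_def, Algebra.commutes]
  rw [genInv, mul_add, hc, mul_smul_comm, gen_sq, smul_add, smul_sub, smul_smul, e, one_smul,
    sub_smul, one_smul]
  rw [Algebra.smul_def (qHalf (-2)) (algebraMap A (Hecke M) (qHalf 2)), ← map_mul, e, map_one]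
  abel

theorem genInv_mul_gen (i : B) : genInv M i * gen M i = 1 := by
  rw [← gen_mul_genInv M i, genInv, mul_add, add_mul, smul_mul_assoc, mul_smul_comm,
    Algebra.commutes]

/-- The generator `T_i` as a unit of the Hecke algebra. -/
def genUnit (i : B) : (Hecke M)ˣ := ⟨gen M i, genInv M i, gen_mul_genInv M i, genInv_mul_gen M i⟩

theorem alternatingWord_reverse (i j : B) (m : ℕ) :
    (CoxeterSystem.alternatingWord i j m).reverse =
      if Even m then CoxeterSystem.alternatingWord j i m
      else CoxeterSystem.alternatingWord i j m := by
  induction m generalizing i j with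
  | zero => simp [CoxeterSystem.alternatingWord]
  | succ m ih =>
    have hc : CoxeterSystem.alternatingWord j i m ++ [j] =
        CoxeterSystem.alternatingWord i j (m + 1) := by
      rw [CoxeterSystem.alternatingWord_succ, List.concat_eq_append]
    rw [CoxeterSystem.alternatingWord_succ, List.concat_eq_append, List.reverse_append,
      List.reverse_singleton, List.singleton_append, ih]
    by_cases h : Even m
    · rw [if_pos h, if_neg (by simpa [Nat.even_add_one] using h),
        hc, CoxeterSystem.alternatingWord_succ', if_pos h]
    · rw [if_neg h, if_pos (by simpa [Nat.even_add_one] using h),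
        CoxeterSystem.alternatingWord_succ', if_neg h]

theorem gen_braid_reverse (i j : B) :
    ((CoxeterSystem.braidWord M i j).reverse.map (gen M)).prod =
      ((CoxeterSystem.braidWord M j i).reverse.map (gen M)).prod := by
  have h := gen_braid M i j
  have hs : M j i = M i j := M.symmetric j i
  simp only [CoxeterSystem.braidWord, alternatingWord_reverse, hs] at h ⊢
  by_cases he : Even (M i j)
  · rw [if_pos he, if_pos he]; exact h.symm
  · rw [if_neg he, if_neg he]; exact h

theorem prod_genInv (l : List B) :
    (l.map (genInv M)).prod = (((l.reverse.map (genUnit M)).prod⁻¹ : (Hecke M)ˣ) : Hecke M) := by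
  induction l with
  | nil => simp
  | cons i l ih =>
    rw [List.map_cons, List.prod_cons, ih, List.reverse_cons, List.map_append, List.prod_append,
      mul_inv_rev, Units.val_mul]
    congr 1
    simp [genUnit]

theorem prod_genUnit (l : List B) :
    (((l.map (genUnit M)).prod : (Hecke M)ˣ) : Hecke M) = (l.map (gen M)).prod := by
  induction l with
  | nil => simp
  | cons i l ih =>
    rw [List.map_cons, List.prod_cons, Units.val_mul, ih, List.map_cons, List.prod_cons]
    rfl

theorem genInv_braid (i j : B) :
    ((CoxeterSystem.braidWord M i j).map (genInv M)).prod =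
      ((CoxeterSystem.braidWord M j i).map (genInv M)).prod := by
  rw [prod_genInv, prod_genInv]
  congr 2
  apply Units.ext
  rw [prod_genUnit, prod_genUnit]
  exact gen_braid_reverse M i j

theorem genInv_quadratic (i : B) :
    (genInv M i + 1) * (genInv M i - algebraMap A (Hecke M) (qHalf (-2))) = 0 := by
  have e : qHalf 2 * qHalf (-2) = 1 := by rw [qHalf_mul]; exact qHalf_zero
  have e1 : genInv M i + 1 = qHalf (-2) • (gen M i + 1) := by
    rw [genInv, smul_add, map_sub, map_one, ← Algebra.algebraMap_eq_smul_one]; abel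
  have e2 : genInv M i - algebraMap A (Hecke M) (qHalf (-2)) =
      qHalf (-2) • (gen M i - algebraMap A (Hecke M) (qHalf 2)) := by
    rw [genInv, smul_sub, map_sub, map_one, Algebra.algebraMap_eq_smul_one (qHalf 2), smul_smul,
      mul_comm, e, one_smul]; abel
  rw [e1, e2, smul_mul_smul_comm, gen_quadratic, smul_zero]

/-- The bar involution on the free algebra, with values in the Hecke algebra. -/
def barFree : FreeAlgebra A B →+* Hecke M :=
  letI : Algebra A (Hecke M) :=
    RingHom.toAlgebra' ((algebraMap A (Hecke M)).comp barA) fun a x =>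
      Algebra.commutes (barA a) x
  (FreeAlgebra.lift A (genInv M)).toRingHom

theorem barFree_ι (i : B) : barFree M (FreeAlgebra.ι A i) = genInv M i := by
  let : Algebra A (Hecke M) :=
    RingHom.toAlgebra' ((algebraMap A (Hecke M)).comp barA) fun a x =>
      Algebra.commutes (barA a) x
  exact FreeAlgebra.lift_ι_apply (genInv M) i

theorem barFree_algebraMap (a : A) :
    barFree M (algebraMap A (FreeAlgebra A B) a) = algebraMap A (Hecke M) (barA a) := by
  let inst : Algebra A (Hecke M) :=
    RingHom.toAlgebra' ((algebraMap A (Hecke M)).comp barA) fun a x =>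
      Algebra.commutes (barA a) x
  exact (FreeAlgebra.lift A (genInv M)).commutes a

theorem barFree_rel {x y : FreeAlgebra A B} (h : HeckeRel M x y) : barFree M x = barFree M y := by
  cases h with
  | quadratic i =>
    rw [map_mul, map_add, map_one, map_sub, barFree_ι, barFree_algebraMap, map_zero, barA_qHalf]
    exact genInv_quadratic M i
  | braid i j =>
    rw [map_list_prod, map_list_prod, List.map_map, List.map_map]
    have e : (barFree M) ∘ (FreeAlgebra.ι A) = genInv M := funext (barFree_ι M)
    rw [e]
    exact genInv_braid M i j

/-- The bar involution of the Hecke algebra: the ring homomorphism with `q^{1/2} ↦ q^{-1/2}` and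
`T_i ↦ T_i⁻¹`; hence `T_w ↦ (T_{w⁻¹})⁻¹`. -/
def bar : Hecke M →+* Hecke M :=
  RingQuot.lift (r := HeckeRel M) ⟨barFree M, fun _ _ h => barFree_rel M h⟩

theorem bar_mk (x : FreeAlgebra A B) : bar M (mk M x) = barFree M x := by
  have h : mk M x = RingQuot.mkRingHom (HeckeRel M) x := by
    rw [← RingQuot.mkAlgHom_coe A (HeckeRel M)]; rfl
  rw [h]
  exact RingQuot.lift_mkRingHom_apply (barFree M) (fun _ _ h => barFree_rel M h) x

theorem bar_gen (i : B) : bar M (gen M i) = genInv M i := by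
  rw [gen, bar_mk, barFree_ι]

theorem bar_algebraMap (a : A) :
    bar M (algebraMap A (Hecke M) a) = algebraMap A (Hecke M) (barA a) := by
  rw [← barFree_algebraMap, ← bar_mk, AlgHom.commutes]

end Generators

section Coxeter

variable {W : Type*} [Group W] {M : CoxeterMatrix B} (cs : CoxeterSystem M W)

/-- The standard partial order (Bruhat order) `y ≤ x` of a Coxeter group: `x` is reached from `y`
by successive right multiplications by reflections, each of which increases the length. -/
def BruhatLE (y x : W) : Prop :=
  Relation.ReflTransGen
    (fun u v => ∃ t, cs.IsReflection t ∧ v = u * t ∧ cs.length u < cs.length v) y x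

/-- A reduced expression of `w`. -/
def redWord (w : W) : List B := (cs.exists_isReduced w).choose

theorem redWord_spec (w : W) : cs.IsReduced (redWord cs w) ∧ w = cs.wordProd (redWord cs w) :=
  (cs.exists_isReduced w).choose_spec

/-- The standard basis element `T_w = T_{i₁} ⋯ T_{iₙ}`, for a reduced expression
`w = s_{i₁} ⋯ s_{iₙ}` (it does not depend on the reduced expression), as a unit of the Hecke
algebra. -/
def T (w : W) : (Hecke M)ˣ := ((redWord cs w).map (genUnit M)).prod

/-- For a family of polynomials `p y w`, the element
`∑_{y ≤ w} (-1)^{|y|+|w|} q^{|w|/2 - |y|} \overline{p y w} T_y`. -/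
def cElement (p : W → W → ℤ[X]) (w : W) : Hecke M :=
  ∑ᶠ (y : W) (_ : BruhatLE cs y w),
    ((-1) ^ (cs.length y + cs.length w) * qHalf ((cs.length w : ℤ) - 2 * (cs.length y : ℤ)) *
      barA (incl (p y w))) • (T cs y : Hecke M)

/-- For a family of polynomials `p y w`, the element `∑_{y ≤ w} q^{-|w|/2} (p y w) T_y`. -/
def cElement' (p : W → W → ℤ[X]) (w : W) : Hecke M :=
  ∑ᶠ (y : W) (_ : BruhatLE cs y w),
    (qHalf (-(cs.length w : ℤ)) * incl (p y w)) • (T cs y : Hecke M)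

/-- The defining property of the Kazhdan–Lusztig polynomials `P_{y,w}`: one has `P_{w,w} = 1`,
`deg P_{y,w} ≤ (|w| - |y| - 1) / 2` for `y < w`, `P_{y,w} = 0` unless `y ≤ w`, and the element
`C_w = ∑_{y ≤ w} (-1)^{|y|+|w|} q^{|w|/2 - |y|} \overline{P_{y,w}} T_y` is fixed by the bar
involution. -/
structure IsKLPolynomials (p : W → W → ℤ[X]) : Prop where
  self : ∀ w, p w w = 1
  degree : ∀ y w, BruhatLE cs y w → y ≠ w →
    2 * (p y w).natDegree + cs.length y + 1 ≤ cs.length w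
  zero : ∀ y w, ¬ BruhatLE cs y w → p y w = 0
  bar_eq : ∀ w, bar M (cElement cs p w) = cElement cs p w

/-- The Kazhdan–Lusztig polynomials `P_{y,w}`: the unique family with the defining property. -/
def P : W → W → ℤ[X] := Classical.epsilon (IsKLPolynomials cs)

/-- The defining property of the polynomials `R_{y,w}`:
`(T_{w⁻¹})⁻¹ = ∑_{y ≤ w} \overline{R_{y,w}} q^{-|y|} T_y`, and `R_{y,w} = 0` unless `y ≤ w`. -/
structure IsRPolynomials (r : W → W → ℤ[X]) : Prop where
  zero : ∀ y w, ¬ BruhatLE cs y w → r y w = 0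
  inv_eq : ∀ w, (((T cs w⁻¹)⁻¹ : (Hecke M)ˣ) : Hecke M) =
    ∑ᶠ (y : W) (_ : BruhatLE cs y w),
      (barA (incl (r y w)) * qHalf (-2 * (cs.length y : ℤ))) • (T cs y : Hecke M)

/-- The polynomials `R_{y,w}`: the unique family with the defining property. -/
def R : W → W → ℤ[X] := Classical.epsilon (IsRPolynomials cs)

open scoped Classical in
/-- The defining property of the inverse Kazhdan–Lusztig polynomials `Q_{y,w}`:
`∑_{y ≤ z ≤ w} (-1)^{|y|+|z|} Q_{y,z} P_{z,w} = δ_{y,w}` for `y ≤ w`, and `Q_{y,w} = 0` unless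
`y ≤ w`. -/
structure IsInverseKLPolynomials (q : W → W → ℤ[X]) : Prop where
  zero : ∀ y w, ¬ BruhatLE cs y w → q y w = 0
  sum_eq : ∀ y w, BruhatLE cs y w →
    ∑ᶠ (z : W) (_ : BruhatLE cs y z ∧ BruhatLE cs z w),
      (-1) ^ (cs.length y + cs.length z) * q y z * P cs z w = if y = w then 1 else 0

/-- The inverse Kazhdan–Lusztig polynomials `Q_{y,w}`: the unique family with the defining
property. -/
def Q : W → W → ℤ[X] := Classical.epsilon (IsInverseKLPolynomials cs)

/-- `Ξ_{y,x} = ∑_{y ≤ y' ≤ x' ≤ x} Q_{y,y'} R_{y',x'} P_{x',x}`. -/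
def Xi (y x : W) : ℤ[X] :=
  ∑ᶠ (z : W × W) (_ : BruhatLE cs y z.1 ∧ BruhatLE cs z.1 z.2 ∧ BruhatLE cs z.2 x),
    Q cs y z.1 * R cs z.1 z.2 * P cs z.2 x

/-- The Kazhdan–Lusztig basis element `C_w`. -/
def C (w : W) : Hecke M := cElement cs (P cs) w

/-- The Kazhdan–Lusztig basis element `C'_w`. -/
def C' (w : W) : Hecke M := cElement' cs (P cs) w

end Coxeter

end KazhdanLusztig

end

/-!
The transition formula is obtained by composing three expansions. Since `C_y` is fixed by the bar
involution, it is a combination of the elements `\overline{T_u}` with coefficients given by the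
`P_{u,y}`; the matrix of the `Q` inverts that of the `P` up to signs, on both sides, so
`∑_y q^{|y|/2} Q_{y,a} C_y = q^{|a|} \overline{T_a}` (`sum_Q_smul_C`). The bar involution is an
involution, so the definition of the `R` gives `T_b = ∑_a R_{a,b} q^{|a|} \overline{T_a}`
(`sum_R_smul_bar_T`). Substituting both into the definition of `C'_x` produces `Ξ`
(`C'_eq_sum_Xi_smul_C`). Both families `C` and `C'` are triangular with respect to `(T_w)` with
units on the diagonal, so they are bases (`exists_basis_of_triangular`).

As `P`, `Q` and `R` are chosen from the families with their defining properties, these families have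
to be shown to exist, and this needs the structure theory of Coxeter groups and Hecke algebras.

* The geometric representation shows that `s_i s_j` has order exactly `M i j`. The parity of the
  number of occurrences of a reflection in the inversion sequence of a word depends only on the
  product of the word, which gives the strong exchange condition. Together they yield Matsumoto's
  theorem (`prod_map_eq_of_isReduced`), so that `T_w` is well defined and the `T_w` span.
* The `T_w` are linearly independent because the Hecke algebra acts on the free module with basis
  `W`. The braid relations for the left operators hold since these commute with the right
  operators, which reduces the verification to the basis vector of `1` (`leftOp_braid`).
* The `R` are constructed by the recursion along `\overline{T_{sv}} = T_s⁻¹ \overline{T_v}`; their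
  supports are controlled by the lifting property of the Bruhat order.
* The `P` are constructed downwards from `w`. For
  `F = ∑_{y < z ≤ w} R_{y,z} P_{z,w}` the involutivity of the bar involution gives
  `q^{|w|-|y|} \overline F = -F`, so `F` is `q^{|w|-|y|} \overline P - P` for minus its own low
  degree part `P`, which satisfies the degree bound (`qHalf_mul_barA_klFamily`).
* The `Q` are constructed by inverting a unitriangular matrix.
-/

noncomputable section

/-! ### The order of a product of two simple reflections -/

namespace CoxeterMatrix

open Module Real Polynomial.Chebyshev

variable {B : Type*} (M : CoxeterMatrix B)

/-- Twice the standard symmetric bilinear form on the simple roots of a Coxeter matrix. For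
`M i j = 0`, which encodes `∞`, the convention `π / 0 = 0` gives the desired value `-2`. -/
def rootPairing (i j : B) : ℝ := -2 * cos (π / M i j)

theorem rootPairing_self (i : B) : M.rootPairing i i = 2 := by
  simp [rootPairing]

theorem rootPairing_comm (i j : B) : M.rootPairing i j = M.rootPairing j i := by
  rw [rootPairing, rootPairing, M.symmetric]

/-- The simple coroot `2 B(α_i, ·)` as a linear form on the space spanned by the simple roots. -/
def coroot (i : B) : Dual ℝ (B →₀ ℝ) := Finsupp.linearCombination ℝ (M.rootPairing i)

theorem coroot_single (i j : B) :
    M.coroot i (Finsupp.single j 1) = M.rootPairing i j := by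
  simp [coroot]

theorem coroot_self (i : B) : M.coroot i (Finsupp.single i 1) = 2 := by
  rw [coroot_single, rootPairing_self]

/-- The reflection by which a simple generator acts in the geometric representation. -/
def rootReflection (i : B) : (B →₀ ℝ) ≃ₗ[ℝ] (B →₀ ℝ) := reflection (M.coroot_self i)

theorem rootPairing_mul_sub_two (i j : B) :
    M.rootPairing i j * M.rootPairing j i - 2 = 2 * cos (2 * π / M i j) := by
  rw [M.rootPairing_comm j i, rootPairing, mul_div_assoc, cos_two_mul]
  ring

/-- For a finite entry `m ≥ 3` of the Coxeter matrix, the sine of `2π/m` does not vanish. -/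
theorem sin_two_pi_div_pos {m : ℕ} (hm : 3 ≤ m) : 0 < sin (2 * π / m) := by
  have h3 : (3 : ℝ) ≤ m := by exact_mod_cast hm
  apply sin_pos_of_pos_of_lt_pi
  · positivity
  · rw [div_lt_iff₀ (by linarith)]
    nlinarith [pi_pos]

/-- The reflections of the geometric representation satisfy the Coxeter relations. -/
theorem isLiftable_rootReflection : M.IsLiftable M.rootReflection := by
  intro i j
  rcases Nat.lt_or_ge (M i j) 3 with hm | hm
  · obtain h | h | h : M i j = 0 ∨ M i j = 1 ∨ M i j = 2 := by omega
    · rw [h, pow_zero]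
    · have hij : i = j := by
        by_contra hne
        exact M.off_diagonal i j hne h
      subst hij
      rw [h, pow_one]
      ext1 z
      exact involutive_reflection (M.coroot_self i) z
    · have h1 : M.rootPairing i j = 0 := by simp [rootPairing, h]
      have h2 : M.rootPairing j i = 0 := by rw [rootPairing_comm, h1]
      ext1 z
      rw [h, rootReflection, rootReflection, reflection_mul_reflection_pow_apply]
      simp only [coroot_single, h1, h2, LinearEquiv.coe_one, id]
      norm_num [S_one, S_zero, S_neg_one]
      module
  · have h3 : (3 : ℝ) ≤ M i j := by exact_mod_cast hm
    have hs := (sin_two_pi_div_pos hm).ne'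
    set θ : ℝ := 2 * π / M i j with hθ
    have hmθ : M i j * θ = 2 * π := by rw [hθ]; field_simp
    have hS (n : ℤ) := S_two_mul_real_cos θ n
    have ht : 2 * cos θ =
        M.coroot i (Finsupp.single j 1) * M.coroot j (Finsupp.single i 1) - 2 := by
      rw [coroot_single, coroot_single, rootPairing_mul_sub_two]
    ext1 z
    rw [rootReflection, rootReflection, reflection_mul_reflection_pow_apply _ _ _ _ _ ht]
    rcases Nat.even_or_odd' (M i j) with ⟨k, hk | hk⟩
    · have e1 : ((M i j : ℤ) - 2) / 2 = (k : ℤ) - 1 := by omega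
      have e2 : ((M i j : ℤ) - 1) / 2 = (k : ℤ) - 1 := by omega
      have h0 : (S ℝ ((k : ℤ) - 1)).eval (2 * cos θ) = 0 := by
        have h := hS ((k : ℤ) - 1)
        have : (((k : ℤ) - 1 : ℤ) + 1 : ℝ) * θ = π := by
          rw [hk] at hmθ; push_cast at hmθ ⊢; linarith
        rw [this, sin_pi] at h
        exact (mul_eq_zero.mp h).resolve_right hs
      rw [e1, e2, h0]
      simp
    · have e1 : ((M i j : ℤ) - 2) / 2 = (k : ℤ) - 1 := by omega
      have e2 : ((M i j : ℤ) - 1) / 2 = (k : ℤ) := by omega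
      have e3 : ((M i j : ℤ) - 3) / 2 = (k : ℤ) - 1 := by omega
      have e4 : (M i j : ℤ) / 2 = (k : ℤ) := by omega
      have h0 : (S ℝ (k : ℤ)).eval (2 * cos θ) + (S ℝ ((k : ℤ) - 1)).eval (2 * cos θ) = 0 := by
        have h := hS k
        have h' := hS ((k : ℤ) - 1)
        have e5 : (((k : ℤ) : ℝ) + 1) * θ = 2 * π - k * θ := by
          rw [hk] at hmθ; push_cast at hmθ ⊢; linarith
        have e6 : (((k : ℤ) - 1 : ℤ) + 1 : ℝ) * θ = k * θ := by push_cast; ring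
        rw [e5, sin_two_pi_sub] at h
        rw [e6] at h'
        refine (mul_eq_zero.mp ?_).resolve_right hs
        rw [add_mul, h, h']; ring
      rw [e1, e2, e3, e4, h0]
      simp

end CoxeterMatrix

namespace CoxeterSystem

open Module Real Polynomial.Chebyshev

variable {B W : Type*} [Group W] {M : CoxeterMatrix B} (cs : CoxeterSystem M W)

/-- The order of `s_i s_j` is exactly `M i j`: the relations of a Coxeter system do not force a
smaller order, as the geometric representation shows. -/
theorem simple_mul_simple_pow_ne_one {i j : B} (hij : i ≠ j) {n : ℕ} (hn : 0 < n)
    (hnM : M i j = 0 ∨ n < M i j) : (cs.simple i * cs.simple j) ^ n ≠ 1 := by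
  intro h1
  have h2 := congrArg (cs.lift ⟨_, M.isLiftable_rootReflection⟩) h1
  rw [map_pow, map_mul, lift_apply_simple, lift_apply_simple, map_one] at h2
  have ht : 2 * cos (2 * π / M i j) =
      M.coroot i (Finsupp.single j 1) * M.coroot j (Finsupp.single i 1) - 2 := by
    rw [M.coroot_single, M.coroot_single, M.rootPairing_mul_sub_two]
  have h3 := DFunLike.congr_fun h2 (Finsupp.single i 1)
  rw [CoxeterMatrix.rootReflection, CoxeterMatrix.rootReflection,
    reflection_mul_reflection_pow_apply_self _ _ _ _ ht] at h3
  have hx := DFunLike.congr_fun h3 i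
  have hy := DFunLike.congr_fun h3 j
  simp [hij, hij.symm, M.coroot_single] at hx hy
  have hS (n : ℤ) := S_two_mul_real_cos (2 * π / M i j) n
  rcases hnM with h0 | hlt
  · simp [h0, CoxeterMatrix.rootPairing, S_eval_two, M.symmetric j i] at hx hy
    omega
  · rcases Nat.lt_or_ge (M i j) 3 with hm | hm
    · have hne := M.off_diagonal i j hij
      have hM2 : M i j = 2 := by omega
      have hn1 : n = 1 := by omega
      subst hn1
      simp [hM2] at hx
    · have hs := CoxeterMatrix.sin_two_pi_div_pos hm
      have h3 : (3 : ℝ) ≤ M i j := by exact_mod_cast hm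
      have hg : M.rootPairing j i ≠ 0 := by
        rw [CoxeterMatrix.rootPairing, M.symmetric]
        refine mul_ne_zero (by norm_num) (cos_pos_of_mem_Ioo ⟨?_, ?_⟩).ne'
        · have : 0 < π / M i j := by positivity
          linarith [pi_pos]
        · rw [div_lt_div_iff₀ (by linarith) (by norm_num)]
          nlinarith [pi_pos]
      set θ : ℝ := 2 * π / M i j with hθ
      have hmθ : M i j * θ = 2 * π := by rw [hθ]; field_simp
      have hy0 := hy.resolve_right hg
      have e1 := hS (n - 1)
      have e2 := hS n
      rw [hy0, zero_mul] at e1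
      rw [hy0, add_zero] at hx
      rw [hx, one_mul] at e2
      push_cast at e1 e2
      rw [sub_add_cancel] at e1
      rw [add_mul, one_mul, sin_add, ← e1, zero_mul, zero_add] at e2
      have hc : cos (n * θ) = 1 := by
        have : (cos (n * θ) - 1) * sin θ = 0 := by linarith
        linarith [(mul_eq_zero.mp this).resolve_right hs.ne']
      have hθ0 : 0 < θ := by positivity
      have hn' : (0 : ℝ) < n := by exact_mod_cast hn
      have hlt' : (n : ℝ) < M i j := by exact_mod_cast hlt
      have := (cos_eq_one_iff_of_lt_of_lt (by nlinarith [pi_pos, mul_pos hn' hθ0])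
        (by nlinarith)).mp hc
      nlinarith [mul_pos hn' hθ0]

end CoxeterSystem

/-! ### The strong exchange condition and Matsumoto's theorem -/

namespace CoxeterSystem

variable {B W : Type*} [Group W] {M : CoxeterMatrix B} (cs : CoxeterSystem M W)

open Classical in
/-- The action of a simple generator on `W × ℤ/2`: it conjugates the first component, and changes
the second one exactly when the first component is the generator itself. -/
def signedConj (i : B) : Function.End (W × ZMod 2) := fun p =>
  (cs.simple i * p.1 * cs.simple i, p.2 + if p.1 = cs.simple i then 1 else 0)

open Classical in
/-- The `k`-th reflection met along the word `(s_i s_j)^n`, read from the right, is the one `t` with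
`s_j t = (s_i s_j)^k`. -/
theorem signedConj_mul_signedConj_pow (i j : B) (n : ℕ) (t : W) (ε : ZMod 2) :
    ((cs.signedConj i * cs.signedConj j) ^ n) (t, ε) =
      ((cs.simple i * cs.simple j) ^ n * t * ((cs.simple i * cs.simple j) ^ n)⁻¹,
        ε + ∑ k ∈ Finset.range (2 * n),
          if cs.simple j * t = (cs.simple i * cs.simple j) ^ k then 1 else 0) := by
  induction n generalizing t ε with
  | zero => simp; rfl
  | succ n ih =>
    set x := cs.simple i * cs.simple j with hx
    have e1 : t = cs.simple j ↔ cs.simple j * t = x ^ 0 := by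
      rw [pow_zero, mul_eq_one_iff_inv_eq, inv_simple, eq_comm]
    have e2 : cs.simple j * t * cs.simple j = cs.simple i ↔ cs.simple j * t = x ^ (0 + 1) := by
      rw [zero_add, pow_one, ← mul_left_inj (cs.simple j), simple_mul_simple_cancel_right]
    have e3 (k : ℕ) : cs.simple j * (x * t * x⁻¹) = x ^ k ↔ cs.simple j * t = x ^ (k + 1 + 1) := by
      have : cs.simple j * x = x⁻¹ * cs.simple j := by
        rw [hx, mul_inv_rev, inv_simple, inv_simple, mul_assoc]
      rw [← mul_assoc, ← mul_assoc, this, mul_inv_eq_iff_eq_mul, mul_assoc, inv_mul_eq_iff_eq_mul,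
        pow_succ, pow_succ, ← mul_assoc, ← pow_succ', pow_succ]
    have e4 : (cs.signedConj i * cs.signedConj j) (t, ε) = (x * t * x⁻¹,
        ε + (if cs.simple j * t = x ^ 0 then 1 else 0) +
          (if cs.simple j * t = x ^ (0 + 1) then 1 else 0)) := by
      change cs.signedConj i (cs.signedConj j (t, ε)) = _
      simp only [signedConj]
      rw [← if_congr e1 rfl rfl, ← if_congr e2 rfl rfl]
      simp [hx, mul_assoc]
    rw [pow_succ]
    change ((cs.signedConj i * cs.signedConj j) ^ n)
      ((cs.signedConj i * cs.signedConj j) (t, ε)) = _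
    rw [e4, ih, show 2 * (n + 1) = 2 * n + 1 + 1 by ring, Finset.sum_range_succ',
      Finset.sum_range_succ', Prod.mk.injEq]
    constructor
    · rw [pow_succ]; group
    · simp only [e3]
      ring

/-- The Coxeter relation of length `2 M i j` holds, as each reflection is met there an even number
of times: `(s_i s_j)^k` has period `M i j` in `k`. -/
theorem isLiftable_signedConj : M.IsLiftable cs.signedConj := by
  classical
  intro i j
  funext ⟨t, ε⟩
  rw [signedConj_mul_signedConj_pow, simple_mul_simple_pow, two_mul, Finset.sum_range_add]
  simp only [pow_add, simple_mul_simple_pow, one_mul, CharTwo.add_self_eq_zero]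
  simp; rfl

/-- The action of `W` on `W × ℤ/2` whose second component records the parity of the number of
occurrences in inversion sequences. -/
def signedConjHom : W →* Function.End (W × ZMod 2) := cs.lift ⟨_, cs.isLiftable_signedConj⟩

open Classical in
theorem signedConjHom_wordProd (ω : List B) (t : W) (ε : ZMod 2) :
    cs.signedConjHom (cs.wordProd ω) (t, ε) =
      (cs.wordProd ω * t * (cs.wordProd ω)⁻¹, ε + (cs.rightInvSeq ω).count t) := by
  induction ω with
  | nil => simp; rfl
  | cons i ω ih =>
    rw [wordProd_cons, map_mul]
    change cs.signedConjHom (cs.simple i) (cs.signedConjHom (cs.wordProd ω) (t, ε)) = _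
    rw [ih, signedConjHom, lift_apply_simple, signedConj, rightInvSeq, List.count_cons,
      Prod.mk.injEq]
    constructor
    · simp [mul_assoc]
    · have : cs.wordProd ω * t * (cs.wordProd ω)⁻¹ = cs.simple i ↔
          ((cs.wordProd ω)⁻¹ * cs.simple i * cs.wordProd ω == t) = true := by
        rw [beq_iff_eq, mul_inv_eq_iff_eq_mul, mul_assoc, inv_mul_eq_iff_eq_mul, eq_comm]
      simp only [this]
      push_cast
      ring

theorem signedConjHom_add (w t : W) (ε : ZMod 2) :
    cs.signedConjHom w (t, ε) =
      (w * t * w⁻¹, ε + (cs.signedConjHom w (t, 0)).2) := by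
  classical
  obtain ⟨ω, -, rfl⟩ := cs.exists_isReduced w
  rw [signedConjHom_wordProd, signedConjHom_wordProd]
  simp

theorem signedConjHom_self {t : W} (ht : cs.IsReflection t) :
    cs.signedConjHom t (t, 0) = (t, 1) := by
  obtain ⟨u, i, h⟩ := id ht
  have h1 : u⁻¹ * t * u⁻¹⁻¹ = cs.simple i := by rw [h]; group
  have e : cs.signedConjHom u (cs.signedConjHom u⁻¹ (t, 0)) = (t, 0) := by
    change (cs.signedConjHom u * cs.signedConjHom u⁻¹) (t, 0) = _
    rw [← map_mul, mul_inv_cancel, map_one]; rfl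
  rw [cs.signedConjHom_add u⁻¹, h1, cs.signedConjHom_add u, Prod.mk.injEq] at e
  have : cs.signedConjHom t (t, 0) =
      cs.signedConjHom u (cs.signedConjHom (cs.simple i) (cs.signedConjHom u⁻¹ (t, 0))) := by
    conv_lhs => rw [h, map_mul, map_mul]
    rw [← h]; rfl
  rw [this, cs.signedConjHom_add u⁻¹, h1, signedConjHom, lift_apply_simple, signedConj,
    ← signedConjHom, cs.signedConjHom_add u, ← h1, Prod.mk.injEq]
  constructor
  · rw [h1, simple_mul_simple_self, one_mul, e.1]
  · simp only [h1, if_true, simple_mul_simple_self, one_mul]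
    linear_combination e.2

/-- The strong exchange condition, in the form that a right inversion of the product of a word
occurs in the right inversion sequence of the word, even if the word is not reduced. -/
theorem IsRightInversion.mem_rightInvSeq {ω : List B} {t : W}
    (h : cs.IsRightInversion (cs.wordProd ω) t) : t ∈ cs.rightInvSeq ω := by
  classical
  obtain ⟨ht, hlt⟩ := h
  by_contra hmem
  -- If `t` did not occur, then it would occur for `w t`, so `w t` would be longer than `w`.
  have h0 : (cs.signedConjHom (cs.wordProd ω) (t, 0)).2 = 0 := by
    rw [signedConjHom_wordProd, List.count_eq_zero_of_not_mem hmem]; simp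
  obtain ⟨ω', hω', hw'⟩ := cs.exists_isReduced (cs.wordProd ω * t)
  have h1 : (cs.signedConjHom (cs.wordProd ω * t) (t, 0)).2 = 1 := by
    have : cs.signedConjHom (cs.wordProd ω * t) (t, 0) =
        cs.signedConjHom (cs.wordProd ω) (cs.signedConjHom t (t, 0)) := by
      rw [map_mul]; rfl
    rw [this, signedConjHom_self cs ht, signedConjHom_add, h0, add_zero]
  have hmem' : t ∈ cs.rightInvSeq ω' := by
    by_contra hn
    rw [hw', signedConjHom_wordProd, List.count_eq_zero_of_not_mem hn] at h1
    simp at h1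
  have := (cs.isRightInversion_of_mem_rightInvSeq hω' hmem').2
  rw [← hw', mul_assoc, ht.mul_self, mul_one] at this
  omega

/-- The strong exchange condition: multiplying on the right by a right inversion amounts to
deleting a letter. -/
theorem exists_wordProd_eraseIdx_of_isRightInversion {ω : List B} {t : W}
    (h : cs.IsRightInversion (cs.wordProd ω) t) :
    ∃ k, ∃ hk : k < ω.length, cs.wordProd ω * t = cs.wordProd (ω.eraseIdx k) ∧
      (cs.rightInvSeq ω)[k]'(by simpa using hk) = t := by
  obtain ⟨k, hk, rfl⟩ := List.getElem_of_mem (IsRightInversion.mem_rightInvSeq cs h)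
  refine ⟨k, by simpa using hk, ?_, rfl⟩
  rw [← wordProd_mul_getD_rightInvSeq, List.getD_eq_getElem _ _ hk]

/-- The strong exchange condition for multiplication on the left by a reflection. -/
theorem exists_wordProd_eraseIdx_of_isLeftInversion {ω : List B} {t : W}
    (h : cs.IsLeftInversion (cs.wordProd ω) t) :
    ∃ k < ω.length, t * cs.wordProd ω = cs.wordProd (ω.eraseIdx k) := by
  have h' : cs.IsRightInversion (cs.wordProd ω) ((cs.wordProd ω)⁻¹ * t * cs.wordProd ω) := by
    refine ⟨by simpa using h.1.conj (cs.wordProd ω)⁻¹, ?_⟩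
    convert h.2 using 2
    group
  obtain ⟨k, hk, e, -⟩ := cs.exists_wordProd_eraseIdx_of_isRightInversion h'
  refine ⟨k, hk, ?_⟩
  rw [← e]; group

theorem mem_rightInvSeq_alternatingWord {i j : B} {n : ℕ} {t : W}
    (h : t ∈ cs.rightInvSeq (alternatingWord i j n)) :
    ∃ p < n, t = (cs.simple j * cs.simple i) ^ p * cs.simple j := by
  induction n generalizing i j t with
  | zero => simp [alternatingWord] at h
  | succ n ih =>
    rw [alternatingWord_succ, rightInvSeq_concat, List.concat_eq_append, List.mem_append,
      List.mem_map, List.mem_singleton] at h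
    rcases h with ⟨u, hu, rfl⟩ | rfl
    · obtain ⟨p, hp, rfl⟩ := ih hu
      refine ⟨p + 1, by omega, ?_⟩
      rw [MulAut.conj_apply, inv_simple, mul_assoc, mul_assoc, ← pow_succ]
      have : SemiconjBy (cs.simple j) (cs.simple i * cs.simple j) (cs.simple j * cs.simple i) := by
        simp [SemiconjBy, mul_assoc]
      exact (this.pow_right (p + 1)).eq
    · exact ⟨0, by omega, by simp⟩

/-- Otherwise `s_i s_j` would have order less than `M i j`. -/
theorem simple_notMem_rightInvSeq_alternatingWord {i j : B} (hij : i ≠ j) {n : ℕ}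
    (hn : M i j = 0 ∨ n < M i j) :
    cs.simple i ∉ cs.rightInvSeq (alternatingWord i j n) := by
  intro h
  obtain ⟨p, hp, e⟩ := cs.mem_rightInvSeq_alternatingWord h
  refine cs.simple_mul_simple_pow_ne_one hij.symm (n := p + 1) (by omega) ?_ ?_
  · rw [M.symmetric]; omega
  · rw [pow_succ, ← mul_assoc, ← e, simple_mul_simple_self]

theorem isReduced_alternatingWord {i j : B} (hij : i ≠ j) {n : ℕ}
    (hn : M i j = 0 ∨ n ≤ M i j) : cs.IsReduced (alternatingWord i j n) := by
  induction n generalizing i j with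
  | zero => simp [IsReduced, alternatingWord]
  | succ n ih =>
    have hr := ih hij.symm (by rw [M.symmetric]; omega)
    rw [IsReduced, alternatingWord_succ, wordProd_concat, List.length_concat, ← hr.eq]
    rw [← not_isRightDescent_iff]
    intro hd
    exact cs.simple_notMem_rightInvSeq_alternatingWord hij.symm (by rw [M.symmetric]; omega)
      (IsRightInversion.mem_rightInvSeq cs ⟨cs.isReflection_simple j, hd⟩)

/-- If `s_i` and `s_j` are right descents of `w`, then `w` has a reduced expression that ends with
an alternating word in `i` and `j` of any prescribed length up to the order of `s_i s_j`. -/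
theorem exists_isReduced_append_alternatingWord {w : W} {i j : B} (hij : i ≠ j)
    (hi : cs.IsRightDescent w i) (hj : cs.IsRightDescent w j) {n : ℕ}
    (hn : M i j = 0 ∨ n ≤ M i j) :
    ∃ ω, cs.IsReduced (ω ++ alternatingWord i j n) ∧
      cs.wordProd (ω ++ alternatingWord i j n) = w := by
  induction n generalizing i j with
  | zero =>
    obtain ⟨ω, hω, e⟩ := cs.exists_isReduced w
    exact ⟨ω, by simpa [alternatingWord] using hω, by simpa [alternatingWord] using e.symm⟩
  | succ n ih =>
    have hn' : M j i = 0 ∨ n < M j i := by rw [M.symmetric]; omega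
    obtain ⟨ω, hω, e⟩ := ih hij.symm hj hi (by omega)
    have hinv : cs.IsRightInversion (cs.wordProd (ω ++ alternatingWord j i n)) (cs.simple j) := by
      rw [e]; exact ⟨cs.isReflection_simple j, hj⟩
    obtain ⟨k, hk, e1, -⟩ := cs.exists_wordProd_eraseIdx_of_isRightInversion hinv
    -- The exchanged letter cannot belong to the alternating part.
    rcases lt_or_ge k ω.length with hk' | hk'
    · have e2 : cs.wordProd (ω.eraseIdx k ++ alternatingWord i j (n + 1)) = w := by
        rw [List.eraseIdx_append_of_lt_length hk', e] at e1
        rw [alternatingWord_succ, List.concat_eq_append, ← List.append_assoc, wordProd_append,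
          ← e1, wordProd_singleton, simple_mul_simple_cancel_right]
      refine ⟨ω.eraseIdx k, ?_, e2⟩
      have hl := hω.eq
      rw [IsReduced, e2, ← e, hl]
      simp only [List.length_append, length_alternatingWord, List.length_eraseIdx_of_lt hk']
      omega
    · rw [List.eraseIdx_append_of_length_le hk', wordProd_append, wordProd_append, mul_assoc,
        mul_left_cancel_iff, ← wordProd_mul_getD_rightInvSeq, mul_left_cancel_iff] at e1
      have hlt : k - ω.length < (cs.rightInvSeq (alternatingWord j i n)).length := by
        simp only [List.length_append, length_alternatingWord] at hk
        simp; omega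
      rw [List.getD_eq_getElem _ _ hlt] at e1
      exact absurd (e1 ▸ List.getElem_mem hlt)
        (cs.simple_notMem_rightInvSeq_alternatingWord hij.symm hn')

/-- Matsumoto's theorem: a function on the generators that satisfies the braid relations in a
monoid has a well-defined product along reduced expressions. -/
theorem prod_map_eq_of_isReduced {G : Type*} [Monoid G] (f : B → G)
    (hf : ∀ i j, ((braidWord M i j).map f).prod = ((braidWord M j i).map f).prod)
    {ω ω' : List B} (hω : cs.IsReduced ω) (hω' : cs.IsReduced ω')
    (h : cs.wordProd ω = cs.wordProd ω') : (ω.map f).prod = (ω'.map f).prod := by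
  induction hn : ω.length generalizing ω ω' with
  | zero =>
    have hl : ω'.length = 0 := by rw [← hω'.eq, ← h, hω.eq, hn]
    rw [List.length_eq_zero_iff.mp hn, List.length_eq_zero_iff.mp hl]
  | succ n ih =>
    have hl : ω'.length = n + 1 := by rw [← hω'.eq, ← h, hω.eq, hn]
    -- Two reduced expressions with the same last letter are dealt with by induction.
    have key : ∀ {ω₁ ω₂ : List B} {i : B}, cs.IsReduced (ω₁ ++ [i]) → cs.IsReduced (ω₂ ++ [i]) →
        (ω₁ ++ [i]).length = n + 1 → cs.wordProd (ω₁ ++ [i]) = cs.wordProd (ω₂ ++ [i]) →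
        ((ω₁ ++ [i]).map f).prod = ((ω₂ ++ [i]).map f).prod := by
      intro ω₁ ω₂ i h₁ h₂ hlen he
      have h₁' : cs.IsReduced ω₁ := by simpa using h₁.take ω₁.length
      have h₂' : cs.IsReduced ω₂ := by simpa using h₂.take ω₂.length
      rw [wordProd_append, wordProd_append, mul_left_inj] at he
      rw [List.map_append, List.prod_append, List.map_append, List.prod_append,
        ih h₁' h₂' he (by simpa using hlen)]
    obtain ⟨u, i, rfl⟩ : ∃ u i, ω = u ++ [i] :=
      ⟨_, _, (List.dropLast_append_getLast (List.ne_nil_of_length_eq_add_one hn)).symm⟩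
    obtain ⟨v, j, rfl⟩ : ∃ v j, ω' = v ++ [j] :=
      ⟨_, _, (List.dropLast_append_getLast (List.ne_nil_of_length_eq_add_one hl)).symm⟩
    by_cases hij : i = j
    · subst hij
      exact key hω hω' hn h
    have desc : ∀ {ω₁ : List B} {k : B}, cs.IsReduced (ω₁ ++ [k]) →
        cs.IsRightDescent (cs.wordProd (ω₁ ++ [k])) k := by
      intro ω₁ k hr
      rw [IsRightDescent, hr.eq, wordProd_append, wordProd_singleton,
        simple_mul_simple_cancel_right, List.length_append]
      exact lt_of_le_of_lt (cs.length_wordProd_le ω₁) (by simp)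
    have hi := desc hω
    have hj := desc hω'
    rw [← h] at hj
    -- With different last letters, both words are compared with words that end in a braid word.
    have hM : M i j ≠ 0 := by
      intro h0
      obtain ⟨x, hx, e⟩ := cs.exists_isReduced_append_alternatingWord hij hi hj (n := n + 2)
        (Or.inl h0)
      have := hx.eq
      rw [e, hω.eq, hn] at this
      simp at this
      omega
    obtain ⟨x, hx, e⟩ := cs.exists_isReduced_append_alternatingWord hij hi hj (n := M i j)
      (Or.inr le_rfl)
    have e' : cs.wordProd (x ++ braidWord M j i) = cs.wordProd (u ++ [i]) := by
      rw [← e, wordProd_append, wordProd_append, ← wordProd_braidWord_eq]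
    have hx' : cs.IsReduced (x ++ braidWord M j i) := by
      rw [IsReduced, e', ← e, hx.eq]
      simp [M.symmetric i j]
    obtain ⟨m, hm⟩ := Nat.exists_eq_succ_of_ne_zero hM
    have hb : x ++ braidWord M i j = (x ++ alternatingWord j i m) ++ [j] := by
      rw [braidWord, hm, Nat.succ_eq_add_one, alternatingWord_succ, List.concat_eq_append,
        List.append_assoc]
    have hb' : x ++ braidWord M j i = (x ++ alternatingWord i j m) ++ [i] := by
      rw [braidWord, M.symmetric, hm, Nat.succ_eq_add_one, alternatingWord_succ,
        List.concat_eq_append, List.append_assoc]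
    have s1 : ((u ++ [i]).map f).prod = ((x ++ braidWord M j i).map f).prod := by
      rw [hb'] at hx' e' ⊢
      exact key hω hx' hn e'.symm
    have s2 : ((v ++ [j]).map f).prod = ((x ++ braidWord M i j).map f).prod := by
      change cs.IsReduced (x ++ braidWord M i j) at hx
      change cs.wordProd (x ++ braidWord M i j) = _ at e
      rw [hb] at hx e ⊢
      exact key hω' hx hl (by rw [e, h])
    rw [s1, s2, List.map_append, List.map_append, List.prod_append, List.prod_append, hf]

end CoxeterSystem

/-! ### Ascents on both sides and the Bruhat order -/

namespace CoxeterSystem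

variable {B W : Type*} [Group W] {M : CoxeterMatrix B} (cs : CoxeterSystem M W)

/-- If `s_i` is a left ascent of `w`, then it is a left ascent of `w s_j` unless `s_i w = w s_j`:
otherwise, deleting a letter from a word of `w s_j` would shorten `s_i w` or remove `s_j`. -/
theorem length_mul_simple_lt_of_length_lt {w : W} {i j : B}
    (h : cs.length w < cs.length (cs.simple i * w))
    (hne : cs.simple i * w ≠ w * cs.simple j) :
    cs.length (w * cs.simple j) < cs.length (cs.simple i * (w * cs.simple j)) := by
  by_contra hn
  have hlt : cs.length (cs.simple i * (w * cs.simple j)) < cs.length (w * cs.simple j) :=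
    lt_of_le_of_ne (not_lt.mp hn) (cs.length_simple_mul_ne _ _)
  rcases cs.length_mul_simple w j with hj | hj
  · obtain ⟨ω, hω, rfl⟩ := cs.exists_isReduced w
    have e : cs.wordProd ω * cs.simple j = cs.wordProd (ω ++ [j]) := by
      rw [wordProd_append, wordProd_singleton]
    have hinv : cs.IsLeftInversion (cs.wordProd (ω ++ [j])) (cs.simple i) := by
      rw [← e]; exact ⟨cs.isReflection_simple i, hlt⟩
    obtain ⟨k, hk, e1⟩ := cs.exists_wordProd_eraseIdx_of_isLeftInversion hinv
    rw [← e] at e1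
    rcases lt_or_ge k ω.length with hk' | hk'
    · rw [List.eraseIdx_append_of_lt_length hk', wordProd_append, wordProd_singleton, ← mul_assoc,
        mul_left_inj] at e1
      have h1 := cs.length_wordProd_le (ω.eraseIdx k)
      rw [← e1, List.length_eraseIdx_of_lt hk'] at h1
      rw [hω.eq] at h
      omega
    · have hk0 : k - ω.length = 0 := by simp at hk; omega
      rw [List.eraseIdx_append_of_length_le hk', hk0, List.eraseIdx_cons_zero, List.append_nil,
        ← mul_assoc] at e1
      apply hne
      conv_rhs => rw [← e1]
      rw [simple_mul_simple_cancel_right]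
  · have := cs.length_mul_simple (cs.simple i * w) j
    rw [mul_assoc] at this
    omega

/-- If `s_i w ≠ w s_j`, then `s_i` is a left descent of both or neither of `w` and `w s_j`. -/
theorem length_mul_simple_lt_iff {w : W} {i j : B} (hne : cs.simple i * w ≠ w * cs.simple j) :
    cs.length (w * cs.simple j) < cs.length (cs.simple i * (w * cs.simple j)) ↔
      cs.length w < cs.length (cs.simple i * w) := by
  refine ⟨fun h => ?_, fun h => cs.length_mul_simple_lt_of_length_lt h hne⟩
  have := cs.length_mul_simple_lt_of_length_lt h (j := j) (by
    rw [simple_mul_simple_cancel_right, ← mul_assoc]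
    intro e
    apply hne
    conv_rhs => rw [← e]
    rw [simple_mul_simple_cancel_right])
  simpa using this

/-- The mirror image of `length_mul_simple_lt_iff`. -/
theorem length_simple_mul_lt_iff {w : W} {i j : B} (hne : cs.simple i * w ≠ w * cs.simple j) :
    cs.length (cs.simple i * w) < cs.length (cs.simple i * w * cs.simple j) ↔
      cs.length w < cs.length (w * cs.simple j) := by
  have := cs.length_mul_simple_lt_iff (w := w⁻¹) (i := j) (j := i) (by
    intro e
    apply hne
    have := congrArg (·⁻¹) e
    simpa using this.symm)
  rw [← cs.length_inv (w⁻¹ * _), ← cs.length_inv (_ * (w⁻¹ * _)), ← cs.length_inv w⁻¹,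
    ← cs.length_inv (_ * w⁻¹)] at this
  simpa [mul_assoc] using this

end CoxeterSystem

namespace KazhdanLusztig

variable {B W : Type*} [Group W] {M : CoxeterMatrix B} {cs : CoxeterSystem M W}

theorem BruhatLE.refl (x : W) : BruhatLE cs x x := Relation.ReflTransGen.refl

theorem BruhatLE.trans {x y z : W} (h : BruhatLE cs x y) (h' : BruhatLE cs y z) :
    BruhatLE cs x z := Relation.ReflTransGen.trans h h'

theorem BruhatLE.eq_or_length_lt {y x : W} (h : BruhatLE cs y x) :
    y = x ∨ cs.length y < cs.length x := by
  induction h with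
  | refl => exact Or.inl rfl
  | tail _ hs ih =>
    obtain ⟨t, -, -, hlt⟩ := hs
    rcases ih with rfl | ih
    · exact Or.inr hlt
    · exact Or.inr (ih.trans hlt)

theorem BruhatLE.length_le {y x : W} (h : BruhatLE cs y x) : cs.length y ≤ cs.length x := by
  rcases h.eq_or_length_lt with rfl | h
  · exact le_rfl
  · exact h.le

theorem BruhatLE.length_lt {y x : W} (h : BruhatLE cs y x) (hne : y ≠ x) :
    cs.length y < cs.length x := h.eq_or_length_lt.resolve_left hne

theorem bruhatLE_simple_mul {w : W} {i : B} (h : cs.length w < cs.length (cs.simple i * w)) :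
    BruhatLE cs w (cs.simple i * w) := by
  refine Relation.ReflTransGen.single ⟨w⁻¹ * cs.simple i * w, ?_, by group, h⟩
  simpa using (cs.isReflection_simple i).conj w⁻¹

/-- Bruhat intervals below an element are finite, because an element has finitely many right
inversions. -/
theorem finite_setOf_bruhatLE (cs : CoxeterSystem M W) (x : W) : {y | BruhatLE cs y x}.Finite := by
  induction hn : cs.length x using Nat.strong_induction_on generalizing x with
  | _ n ih =>
    obtain ⟨ω, hω, rfl⟩ := cs.exists_isReduced x
    have hsub : {y | BruhatLE cs y (cs.wordProd ω)} ⊆ {cs.wordProd ω} ∪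
        ⋃ t ∈ {t | t ∈ cs.rightInvSeq ω}, {y | BruhatLE cs y (cs.wordProd ω * t)} := by
      intro y hy
      rcases Relation.ReflTransGen.cases_tail hy with e | ⟨u, hu, t, ht, hv, hlt⟩
      · exact Or.inl e.symm
      · right
        have e : cs.wordProd ω * t = u := by rw [hv, mul_assoc, ht.mul_self, mul_one]
        simp only [Set.mem_iUnion]
        refine ⟨t, ?_, ?_⟩
        · exact CoxeterSystem.IsRightInversion.mem_rightInvSeq cs ⟨ht, by rwa [e]⟩
        · rw [e]; exact hu
    refine Set.Finite.subset ((Set.finite_singleton _).union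
      (Set.Finite.biUnion (List.finite_toSet _) fun t ht => ?_)) hsub
    exact ih _ (hn ▸ (cs.isRightInversion_of_mem_rightInvSeq hω ht).2) _ rfl

/-- Half of the lifting property: left multiplication by a generator nearly preserves the Bruhat
order. -/
theorem BruhatLE.simple_mul {y v : W} (h : BruhatLE cs y v) (i : B) :
    BruhatLE cs (cs.simple i * y) v ∨ BruhatLE cs (cs.simple i * y) (cs.simple i * v) := by
  induction h using Relation.ReflTransGen.head_induction_on with
  | refl => exact Or.inr (BruhatLE.refl _)
  | @head u u' hs hu' ih =>
    obtain ⟨t, ht, rfl, hlt⟩ := hs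
    by_cases hlt' : cs.length (cs.simple i * u) < cs.length (cs.simple i * (u * t))
    · have hle : BruhatLE cs (cs.simple i * u) (cs.simple i * (u * t)) :=
        Relation.ReflTransGen.single ⟨t, ht, by rw [mul_assoc], hlt'⟩
      exact ih.imp hle.trans hle.trans
    -- Otherwise `s` reverses the step, which is then itself left multiplication by `s`.
    · left
      suffices cs.simple i * u = u * t by rw [this]; exact hu'
      have hlt2 : cs.length (cs.simple i * (u * t)) < cs.length (cs.simple i * u) := by
        refine lt_of_le_of_ne (not_lt.mp hlt') ?_
        rw [← mul_assoc]
        exact ht.length_mul_left_ne _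
      obtain ⟨ω, hω, rfl⟩ := cs.exists_isReduced u
      have hinv : cs.IsRightInversion (cs.wordProd (i :: ω)) t := by
        rw [CoxeterSystem.wordProd_cons]
        exact ⟨ht, by rwa [mul_assoc]⟩
      obtain ⟨k, hk, e, -⟩ := cs.exists_wordProd_eraseIdx_of_isRightInversion hinv
      rw [CoxeterSystem.wordProd_cons, mul_assoc] at e
      cases k with
      | zero =>
        rw [List.eraseIdx_cons_zero] at e
        conv_lhs => rw [← e]
        rw [CoxeterSystem.simple_mul_simple_cancel_left]
      | succ k =>
        rw [List.eraseIdx_cons_succ, CoxeterSystem.wordProd_cons, mul_right_inj] at e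
        have h1 := cs.length_wordProd_le (ω.eraseIdx k)
        have hk' : k < ω.length := by simpa using hk
        rw [← e, List.length_eraseIdx_of_lt hk'] at h1
        rw [hω.eq] at hlt
        omega

theorem BruhatLE.simple_mul_le {y v : W} (h : BruhatLE cs y v) {i : B}
    (hv : cs.length v < cs.length (cs.simple i * v)) :
    BruhatLE cs (cs.simple i * y) (cs.simple i * v) :=
  (h.simple_mul i).elim (fun h' => h'.trans (bruhatLE_simple_mul hv)) id

variable (cs) in
/-- The Bruhat interval below `x`, as a finite set. -/
def lowerSet (x : W) : Finset W := (finite_setOf_bruhatLE cs x).toFinset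

@[simp]
theorem mem_lowerSet {x y : W} : y ∈ lowerSet cs x ↔ BruhatLE cs y x := by
  simp [lowerSet]

end KazhdanLusztig

/-! ### The standard basis of the Hecke algebra -/

namespace KazhdanLusztig

variable {B W : Type*} [Group W] {M : CoxeterMatrix B} (cs : CoxeterSystem M W)

/-- `T_w` may be computed from any reduced expression, by Matsumoto's theorem. -/
theorem T_wordProd {ω : List B} (hω : cs.IsReduced ω) :
    T cs (cs.wordProd ω) = (ω.map (genUnit M)).prod := by
  obtain ⟨h, e⟩ := redWord_spec cs (cs.wordProd ω)
  refine cs.prod_map_eq_of_isReduced (genUnit M) (fun i j => ?_) h hω e.symm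
  ext1
  rw [prod_genUnit, prod_genUnit, gen_braid]

theorem T_one : T cs 1 = 1 := by
  rw [← cs.wordProd_nil, T_wordProd cs (by simp [CoxeterSystem.IsReduced])]
  simp

theorem T_simple_mul {i : B} {w : W} (h : cs.length w < cs.length (cs.simple i * w)) :
    (T cs (cs.simple i * w) : Hecke M) = gen M i * T cs w := by
  obtain ⟨ω, hω, rfl⟩ := cs.exists_isReduced w
  have hr : cs.IsReduced (i :: ω) := by
    have := cs.length_simple_mul (cs.wordProd ω) i
    rw [CoxeterSystem.IsReduced, CoxeterSystem.wordProd_cons, List.length_cons, ← hω.eq]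
    omega
  rw [← CoxeterSystem.wordProd_cons, T_wordProd cs hr, T_wordProd cs hω, List.map_cons,
    List.prod_cons, Units.val_mul]
  rfl

theorem gen_mul_T_of_length_lt {i : B} {w : W} (h : cs.length (cs.simple i * w) < cs.length w) :
    gen M i * T cs w =
      qHalf 2 • (T cs (cs.simple i * w) : Hecke M) + (qHalf 2 - 1) • (T cs w : Hecke M) := by
  have e : (T cs w : Hecke M) = gen M i * T cs (cs.simple i * w) := by
    rw [← T_simple_mul cs (by simpa using h), CoxeterSystem.simple_mul_simple_cancel_left]
  rw [e, ← mul_assoc, gen_sq, add_mul, sub_mul, smul_mul_assoc, ← Algebra.smul_def]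
  module

theorem genInv_mul_T_of_lt {i : B} {w : W} (h : cs.length w < cs.length (cs.simple i * w)) :
    genInv M i * T cs w = qHalf (-2) • (T cs (cs.simple i * w) : Hecke M) +
      (qHalf (-2) - 1) • (T cs w : Hecke M) := by
  rw [genInv, add_mul, smul_mul_assoc, ← T_simple_mul cs h, ← Algebra.smul_def]

theorem genInv_mul_T_of_gt {i : B} {w : W} (h : cs.length (cs.simple i * w) < cs.length w) :
    genInv M i * T cs w = T cs (cs.simple i * w) := by
  have e : (T cs w : Hecke M) = gen M i * T cs (cs.simple i * w) := by
    rw [← T_simple_mul cs (by simpa using h), CoxeterSystem.simple_mul_simple_cancel_left]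
  rw [e, ← mul_assoc, genInv_mul_gen, one_mul]

theorem gen_mul_mem_span_T (i : B) {x : Hecke M}
    (hx : x ∈ Submodule.span A (Set.range fun w => (T cs w : Hecke M))) :
    gen M i * x ∈ Submodule.span A (Set.range fun w => (T cs w : Hecke M)) := by
  induction hx using Submodule.span_induction with
  | mem x h =>
    obtain ⟨w, rfl⟩ := h
    have hT (w : W) : (T cs w : Hecke M) ∈
        Submodule.span A (Set.range fun w => (T cs w : Hecke M)) :=
      Submodule.subset_span ⟨w, rfl⟩
    rcases lt_or_gt_of_ne (cs.length_simple_mul_ne w i) with h | h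
    · exact gen_mul_T_of_length_lt cs h ▸
        add_mem (Submodule.smul_mem _ _ (hT _)) (Submodule.smul_mem _ _ (hT _))
    · exact T_simple_mul cs h ▸ hT _
  | zero => simp
  | add x y _ _ hx hy => rw [mul_add]; exact add_mem hx hy
  | smul a x _ hx => rw [mul_smul_comm]; exact Submodule.smul_mem _ _ hx

theorem mk_surjective : Function.Surjective (mk M) := RingQuot.mkAlgHom_surjective A (HeckeRel M)

theorem span_T : Submodule.span A (Set.range fun w => (T cs w : Hecke M)) = ⊤ := by
  have key : ∀ a : FreeAlgebra A B,
      ∀ x ∈ Submodule.span A (Set.range fun w => (T cs w : Hecke M)),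
        mk M a * x ∈ Submodule.span A (Set.range fun w => (T cs w : Hecke M)) := by
    intro a
    induction a using FreeAlgebra.induction with
    | grade0 r =>
      intro x hx
      rw [AlgHom.commutes, ← Algebra.smul_def]
      exact Submodule.smul_mem _ _ hx
    | grade1 i => exact fun x hx => gen_mul_mem_span_T cs i hx
    | mul a b ha hb => intro x hx; rw [map_mul, mul_assoc]; exact ha _ (hb _ hx)
    | add a b ha hb => intro x hx; rw [map_add, add_mul]; exact add_mem (ha _ hx) (hb _ hx)
  rw [eq_top_iff]
  intro x _
  obtain ⟨a, rfl⟩ := mk_surjective x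
  have := key a 1 (Submodule.subset_span ⟨1, by simp [T_one]⟩)
  rwa [mul_one] at this

/-- The coefficient of `T_{sw}` in `T_s T_w`, where `up` says whether `sw` is longer than `w`. -/
def coeffMove (up : Prop) : A := open Classical in if up then 1 else qHalf 2

/-- The coefficient of `T_w` in `T_s T_w`, where `up` says whether `sw` is longer than `w`. -/
def coeffStay (up : Prop) : A := open Classical in if up then 0 else qHalf 2 - 1

/-- The operator on the free module with basis `W` that left multiplication by `T_i` induces. -/
def leftOp (i : B) : Module.End A (W →₀ A) :=
  Finsupp.linearCombination A fun w =>
    Finsupp.single (cs.simple i * w) (coeffMove (cs.length w < cs.length (cs.simple i * w))) +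
      Finsupp.single w (coeffStay (cs.length w < cs.length (cs.simple i * w)))

/-- The operator on the free module with basis `W` that right multiplication by `T_i` induces. -/
def rightOp (i : B) : Module.End A (W →₀ A) :=
  Finsupp.linearCombination A fun w =>
    Finsupp.single (w * cs.simple i) (coeffMove (cs.length w < cs.length (w * cs.simple i))) +
      Finsupp.single w (coeffStay (cs.length w < cs.length (w * cs.simple i)))

theorem leftOp_single (i : B) (w : W) (a : A) : leftOp cs i (Finsupp.single w a) =
    Finsupp.single (cs.simple i * w) (a * coeffMove (cs.length w < cs.length (cs.simple i * w))) +
      Finsupp.single w (a * coeffStay (cs.length w < cs.length (cs.simple i * w))) := by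
  simp [leftOp]

theorem rightOp_single (i : B) (w : W) (a : A) : rightOp cs i (Finsupp.single w a) =
    Finsupp.single (w * cs.simple i) (a * coeffMove (cs.length w < cs.length (w * cs.simple i))) +
      Finsupp.single w (a * coeffStay (cs.length w < cs.length (w * cs.simple i))) := by
  simp [rightOp]

theorem leftOp_rightOp_commute (i j : B) : Commute (leftOp cs i) (rightOp cs j) := by
  refine Finsupp.lhom_ext fun w a => ?_
  rw [Module.End.mul_apply, Module.End.mul_apply, rightOp_single, leftOp_single, map_add, map_add,
    leftOp_single, leftOp_single, rightOp_single, rightOp_single]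
  by_cases hne : cs.simple i * w = w * cs.simple j
  · have h1 : cs.simple i * (w * cs.simple j) = w := by
      rw [← hne, CoxeterSystem.simple_mul_simple_cancel_left]
    simp only [hne, h1, CoxeterSystem.simple_mul_simple_cancel_right]
  · have h2 := cs.length_simple_mul_lt_iff hne
    rw [mul_assoc] at h2
    simp only [cs.length_mul_simple_lt_iff hne, mul_assoc (cs.simple i), h2]
    generalize coeffMove (cs.length w < cs.length (cs.simple i * w)) = p
    generalize coeffStay (cs.length w < cs.length (cs.simple i * w)) = q
    generalize coeffMove (cs.length w < cs.length (w * cs.simple j)) = r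
    generalize coeffStay (cs.length w < cs.length (w * cs.simple j)) = s
    rw [mul_right_comm a r p, mul_right_comm a r q, mul_right_comm a s p, mul_right_comm a s q]
    abel

theorem leftOp_quadratic (i : B) :
    (leftOp cs i + 1) * (leftOp cs i - algebraMap A (Module.End A (W →₀ A)) (qHalf 2)) = 0 := by
  classical
  refine Finsupp.lhom_ext fun w a => ?_
  have e : cs.simple i * (cs.simple i * w) = w := cs.simple_mul_simple_cancel_left i
  simp only [Module.End.mul_apply, LinearMap.add_apply, LinearMap.sub_apply, Module.End.one_apply,
    Module.algebraMap_end_apply, LinearMap.zero_apply, leftOp_single, map_sub, map_add, e,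
    Finsupp.smul_single, smul_eq_mul]
  rcases lt_or_gt_of_ne (cs.length_simple_mul_ne w i) with h | h
  · simp only [coeffMove, coeffStay, h, not_lt_of_gt h, if_true, if_false]
    ext v : 1
    simp only [Finsupp.add_apply, Finsupp.sub_apply, Finsupp.single_apply, Finsupp.zero_apply]
    split_ifs <;> ring
  · simp only [coeffMove, coeffStay, h, not_lt_of_gt h, if_true, if_false]
    ext v : 1
    simp only [Finsupp.add_apply, Finsupp.sub_apply, Finsupp.single_apply, Finsupp.zero_apply]
    split_ifs <;> ring

/-- Right multiplications move the basis vector of `1` to every basis vector, so an operator that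
commutes with them is determined by its value there. -/
theorem eq_of_commute_rightOp {D D' : Module.End A (W →₀ A)}
    (hD : ∀ j, Commute D (rightOp cs j)) (hD' : ∀ j, Commute D' (rightOp cs j))
    (h1 : D (Finsupp.single 1 1) = D' (Finsupp.single 1 1)) : D = D' := by
  have key : ∀ w : W, D (Finsupp.single w 1) = D' (Finsupp.single w 1) := by
    intro w
    induction hn : cs.length w generalizing w with
    | zero => rw [cs.length_eq_zero_iff.mp hn, h1]
    | succ n ih =>
      obtain ⟨j, hj⟩ := cs.exists_rightDescent_of_ne_one (w := w) (by
        rintro rfl; simp at hn)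
      have hw : rightOp cs j (Finsupp.single (w * cs.simple j) 1) = Finsupp.single w 1 := by
        rw [CoxeterSystem.IsRightDescent] at hj
        simp [rightOp_single, coeffMove, coeffStay, hj]
      rw [← hw, ← Module.End.mul_apply, ← Module.End.mul_apply, (hD j).eq, (hD' j).eq,
        Module.End.mul_apply, Module.End.mul_apply, ih _ (by
          rw [CoxeterSystem.isRightDescent_iff] at hj; omega)]
  refine Finsupp.lhom_ext fun w a => ?_
  rw [← mul_one a, ← smul_eq_mul, ← Finsupp.smul_single, map_smul, map_smul, key]

theorem prod_leftOp_single_one {ω : List B} (hω : cs.IsReduced ω) :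
    (ω.map (leftOp cs)).prod (Finsupp.single 1 1) = Finsupp.single (cs.wordProd ω) 1 := by
  induction ω with
  | nil => simp
  | cons i ω ih =>
    have hr : cs.IsReduced ω := by simpa using hω.drop 1
    have hlt : cs.length (cs.wordProd ω) < cs.length (cs.simple i * cs.wordProd ω) := by
      rw [← CoxeterSystem.wordProd_cons, hω.eq, hr.eq]; simp
    rw [List.map_cons, List.prod_cons, Module.End.mul_apply, ih hr, leftOp_single,
      CoxeterSystem.wordProd_cons]
    simp [coeffMove, coeffStay, hlt]

/-- Both sides commute with the right multiplications and agree at the basis vector of `1`, which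
they send to that of the common product of the two braid words. -/
theorem leftOp_braid (i j : B) :
    ((CoxeterSystem.braidWord M i j).map (leftOp cs)).prod =
      ((CoxeterSystem.braidWord M j i).map (leftOp cs)).prod := by
  by_cases hij : i = j
  · rw [hij]
  have hc (l : List B) (k : B) : Commute (l.map (leftOp cs)).prod (rightOp cs k) := by
    refine Commute.list_prod_left _ _ fun x hx => ?_
    obtain ⟨i, -, rfl⟩ := List.mem_map.mp hx
    exact leftOp_rightOp_commute cs i k
  refine eq_of_commute_rightOp cs (hc _) (hc _) ?_
  rw [prod_leftOp_single_one cs (cs.isReduced_alternatingWord hij (Or.inr le_rfl)),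
    prod_leftOp_single_one cs (cs.isReduced_alternatingWord (Ne.symm hij) (Or.inr le_rfl)),
    cs.wordProd_braidWord_eq]

/-- The left regular representation of the Hecke algebra, realized on the free module with
basis `W`. -/
def leftRegular : Hecke M →ₐ[A] Module.End A (W →₀ A) :=
  RingQuot.liftAlgHom A ⟨FreeAlgebra.lift A (leftOp cs), fun x y h => by
    cases h with
    | quadratic i =>
      simpa using leftOp_quadratic cs i
    | braid i j =>
      rw [map_list_prod, map_list_prod, List.map_map, List.map_map]
      have e : (FreeAlgebra.lift A (leftOp cs)) ∘ (FreeAlgebra.ι A) = leftOp cs :=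
        funext (FreeAlgebra.lift_ι_apply _)
      rw [e]
      exact leftOp_braid cs i j⟩

theorem leftRegular_gen (i : B) : leftRegular cs (gen M i) = leftOp cs i := by
  rw [leftRegular, gen, mk]
  erw [RingQuot.liftAlgHom_mkAlgHom_apply]
  exact FreeAlgebra.lift_ι_apply _ _

/-- Evaluation at the basis vector of `1` sends `T_w` to the basis vector of `w`. -/
theorem leftRegular_T (w : W) :
    leftRegular cs (T cs w) (Finsupp.single 1 1) = Finsupp.single w 1 := by
  obtain ⟨ω, hω, rfl⟩ := cs.exists_isReduced w
  rw [T_wordProd cs hω, prod_genUnit, map_list_prod, List.map_map,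
    ← prod_leftOp_single_one cs hω]
  congr 3
  exact funext fun i => leftRegular_gen cs i

theorem linearIndependent_T : LinearIndependent A fun w => (T cs w : Hecke M) := by
  let φ : Hecke M →ₗ[A] (W →₀ A) :=
    (LinearMap.applyₗ (Finsupp.single 1 1)).comp (leftRegular cs).toLinearMap
  refine LinearIndependent.of_comp φ ?_
  have e : (φ ∘ fun w => (T cs w : Hecke M)) = fun w => Finsupp.single w 1 :=
    funext fun w => leftRegular_T cs w
  rw [e]
  exact Finsupp.linearIndependent_single_one A W

/-- The standard basis `(T_w)` of the Hecke algebra. -/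
def basisT : Module.Basis W A (Hecke M) :=
  Module.Basis.mk (linearIndependent_T cs) (span_T cs).ge

@[simp]
theorem basisT_apply (w : W) : basisT cs w = T cs w := Module.Basis.mk_apply _ _ w

end KazhdanLusztig

/-! ### The bar involution and the polynomials `R` -/

namespace KazhdanLusztig

theorem barA_barA (a : A) : barA (barA a) = a := LaurentPolynomial.involutive_invert a

theorem incl_X : incl X = qHalf 2 := by simp [incl]

theorem incl_monomial (n : ℕ) (a : ℤ) :
    incl (monomial n a) = LaurentPolynomial.C a * qHalf (2 * n) := by
  simp [incl, qHalf, LaurentPolynomial.T_pow, mul_comm]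

variable {B W : Type*} [Group W] {M : CoxeterMatrix B} (cs : CoxeterSystem M W)

/-- Bruhat-restricted sums of a function that vanishes off the restriction, as sums over a larger
finite set. -/
theorem finsum_bruhatLE {E : Type*} [AddCommMonoid E] {x : W} (f : W → E) {s : Finset W}
    (hs : lowerSet cs x ⊆ s) (hf : ∀ y, ¬ BruhatLE cs y x → f y = 0) :
    ∑ᶠ (y : W) (_ : BruhatLE cs y x), f y = ∑ y ∈ s, f y := by
  refine finsum_cond_eq_sum_of_cond_iff f fun {y} hy => ?_
  have hle : BruhatLE cs y x := by
    by_contra hn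
    exact hy (hf y hn)
  exact ⟨fun _ => hs (by simpa using hle), fun _ => hle⟩

theorem bar_smul (a : A) (x : Hecke M) : bar M (a • x) = barA a • bar M x := by
  rw [Algebra.smul_def, map_mul, bar_algebraMap, ← Algebra.smul_def]

theorem bar_genInv (i : B) : bar M (genInv M i) = gen M i := by
  have h : bar M (genInv M i) * genInv M i = 1 := by
    have h := congrArg (bar M) (genInv_mul_gen M i)
    rwa [map_mul, bar_gen, map_one] at h
  calc bar M (genInv M i) = bar M (genInv M i) * (genInv M i * gen M i) := by
        rw [genInv_mul_gen, mul_one]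
    _ = gen M i := by rw [← mul_assoc, h, one_mul]

theorem bar_bar (x : Hecke M) : bar M (bar M x) = x := by
  obtain ⟨a, rfl⟩ := mk_surjective x
  induction a using FreeAlgebra.induction with
  | grade0 r => rw [AlgHom.commutes, bar_algebraMap, bar_algebraMap, barA_barA]
  | grade1 i => exact (congrArg _ (bar_gen M i)).trans (bar_genInv i)
  | mul a b ha hb => rw [map_mul, map_mul, map_mul, ha, hb]
  | add a b ha hb => rw [map_add, map_add, map_add, ha, hb]

/-- The bar involution sends `T_w` to the inverse of `T_{w⁻¹}`. -/
theorem bar_T (w : W) : bar M (T cs w) = ((T cs w⁻¹)⁻¹ : (Hecke M)ˣ) := by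
  obtain ⟨ω, hω, rfl⟩ := cs.exists_isReduced w
  rw [← cs.wordProd_reverse, T_wordProd cs hω, T_wordProd cs hω.reverse, prod_genUnit,
    map_list_prod, List.map_map, ← prod_genInv]
  congr 2
  exact funext fun i => bar_gen M i

/-- The coefficient `\overline{R} q^{-|y|}` of `T_y` in an expansion of `\overline{T_w}`. -/
def rCoeff (r : W → ℤ[X]) (y : W) : A := barA (incl (r y)) * qHalf (-2 * (cs.length y : ℤ))

/-- The properties of the family `y ↦ R_{y,w}` for a fixed `w` which the recursion in `w`
preserves. -/
structure IsRFamily (w : W) (r : W → ℤ[X]) : Prop where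
  zero : ∀ y, ¬ BruhatLE cs y w → r y = 0
  bar_eq : bar M (T cs w) = ∑ y ∈ lowerSet cs w, rCoeff cs r y • (T cs y : Hecke M)
  self : r w = 1
  barA_eq : ∀ y, barA (incl (r y)) =
    (-1) ^ (cs.length y + cs.length w) * qHalf (2 * ((cs.length y : ℤ) - cs.length w)) * incl (r y)

theorem isRFamily_one : IsRFamily cs 1 (fun y => open Classical in if y = 1 then 1 else 0) := by
  classical
  have h1 : ∀ y : W, BruhatLE cs y 1 ↔ y = 1 := by
    refine fun y => ⟨fun h => ?_, fun h => h ▸ BruhatLE.refl _⟩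
    have := h.length_le
    rw [cs.length_one] at this
    exact cs.length_eq_zero_iff.mp (by omega)
  have hl : lowerSet cs 1 = {1} := by
    ext y
    simp [h1]
  refine ⟨fun y hy => if_neg (by rwa [← h1]), ?_, if_pos rfl, fun y => ?_⟩
  · simp [hl, rCoeff, T_one, qHalf_zero]
  · by_cases hy : y = 1
    · simp [hy, qHalf_zero]
    · simp [hy]

/-- The recursion `R_{y,sv} = R_{sy,v}` for `sy < y`, and
`R_{y,sv} = (q - 1) R_{y,v} + q R_{sy,v}` for `sy > y`. -/
def rStep (i : B) (r : W → ℤ[X]) (y : W) : ℤ[X] :=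
  if cs.length (cs.simple i * y) < cs.length y then r (cs.simple i * y)
  else (X - 1) * r y + X * r (cs.simple i * y)

theorem sum_simple_mul {E : Type*} [AddCommMonoid E] (i : B) {s : Finset W}
    (hs : ∀ y ∈ s, cs.simple i * y ∈ s) (f : W → E) :
    ∑ y ∈ s, f (cs.simple i * y) = ∑ y ∈ s, f y :=
  Finset.sum_nbij' (cs.simple i * ·) (cs.simple i * ·) hs hs (by simp) (by simp) (by simp)

/-- The recursion follows from `\overline{T_{sv}} = T_s⁻¹ \overline{T_v}`. -/
theorem isRFamily_rStep {v : W} {i : B} (hv : cs.length v < cs.length (cs.simple i * v))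
    {r : W → ℤ[X]} (hr : IsRFamily cs v r) :
    IsRFamily cs (cs.simple i * v) (rStep cs i r) := by
  have hlv : cs.length (cs.simple i * v) = cs.length v + 1 := by
    have := cs.length_simple_mul v i
    omega
  have hss (y : W) : cs.simple i * (cs.simple i * y) = y := cs.simple_mul_simple_cancel_left i
  have hsub : ∀ y, BruhatLE cs y v → BruhatLE cs y (cs.simple i * v) :=
    fun y hy => hy.trans (bruhatLE_simple_mul hv)
  have hstab : ∀ y ∈ lowerSet cs (cs.simple i * v),
      cs.simple i * y ∈ lowerSet cs (cs.simple i * v) := by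
    intro y hy
    rw [mem_lowerSet] at hy ⊢
    rcases hy.simple_mul i with h | h
    · exact h
    · rw [hss] at h
      exact hsub _ h
  have hcase (y : W) : (cs.length (cs.simple i * y) < cs.length y ∧
      cs.length y = cs.length (cs.simple i * y) + 1) ∨
      (cs.length y < cs.length (cs.simple i * y) ∧
        cs.length (cs.simple i * y) = cs.length y + 1) := by
    have := cs.length_simple_mul y i
    omega
  refine ⟨fun y hy => ?_, ?_, ?_, fun y => ?_⟩
  · have h1 : r (cs.simple i * y) = 0 := by
      refine hr.zero _ fun h => hy ?_
      have := h.simple_mul_le hv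
      rwa [hss] at this
    have h2 : r y = 0 := hr.zero _ fun h => hy (hsub _ h)
    simp [rStep, h1, h2]
  · have hext : bar M (T cs v) =
        ∑ y ∈ lowerSet cs (cs.simple i * v), rCoeff cs r y • (T cs y : Hecke M) := by
      rw [hr.bar_eq]
      refine Finset.sum_subset (fun y hy => ?_) fun y _ hy => ?_
      · rw [mem_lowerSet] at hy ⊢
        exact hsub _ hy
      · rw [mem_lowerSet] at hy
        simp [rCoeff, hr.zero _ hy]
    -- Left multiplication by `T_s⁻¹` sends `T_y` to a combination of `T_{sy}` and `T_y`.
    let g : W → A := fun y =>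
      if cs.length (cs.simple i * y) < cs.length y then 1 else qHalf (-2)
    let h : W → A := fun y =>
      if cs.length (cs.simple i * y) < cs.length y then 0 else qHalf (-2) - 1
    have hT (y : W) : genInv M i * T cs y =
        g y • (T cs (cs.simple i * y) : Hecke M) + h y • (T cs y : Hecke M) := by
      rcases hcase y with hy | hy
      · simp [g, h, hy.1, genInv_mul_T_of_gt cs hy.1]
      · simp [g, h, not_lt_of_gt hy.1, genInv_mul_T_of_lt cs hy.1]
    rw [T_simple_mul cs hv, map_mul, bar_gen, hext, Finset.mul_sum]
    have hsum := sum_simple_mul cs i hstab fun y =>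
      (rCoeff cs r y * g y) • (T cs (cs.simple i * y) : Hecke M)
    simp only [mul_smul_comm, hT, smul_add, smul_smul, Finset.sum_add_distrib]
    rw [← hsum, ← Finset.sum_add_distrib]
    refine Finset.sum_congr rfl fun y _ => ?_
    rw [hss, ← add_smul]
    congr 1
    rcases hcase y with hy | hy
    · simp only [g, h, rCoeff, rStep, hss, hy.1, not_lt_of_gt hy.1, if_true, if_false]
      rw [mul_assoc, qHalf_mul, hy.2]
      push_cast
      ring_nf
    · simp only [g, h, rCoeff, rStep, hss, hy.1, not_lt_of_gt hy.1, if_true, if_false, map_add,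
        map_mul, map_sub, map_one, incl_X, barA_qHalf]
      rw [hy.2]
      have : qHalf (-2 * ((cs.length y + 1 : ℕ) : ℤ)) =
          qHalf (-2) * qHalf (-2 * (cs.length y : ℤ)) := by
        rw [qHalf_mul]; push_cast; ring_nf
      rw [this]
      ring
  · simp [rStep, hss, hv, hr.self]
  · rcases hcase y with hy | hy
    · simp only [rStep, hy.1, if_true]
      rw [hr.barA_eq, hy.2, hlv]
      congr 2
      · ring
      · push_cast; ring_nf
    · simp only [rStep, not_lt_of_gt hy.1, if_false, map_add, map_mul, map_sub, map_one, incl_X,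
        barA_qHalf]
      rw [hr.barA_eq, hr.barA_eq (cs.simple i * y), hy.2, hlv]
      have e1 : qHalf (2 * ((cs.length y : ℤ) - (cs.length v + 1 : ℕ))) =
          qHalf (-2) * qHalf (2 * ((cs.length y : ℤ) - cs.length v)) := by
        rw [qHalf_mul]; push_cast; ring_nf
      have e2 : qHalf (2 * (((cs.length y + 1 : ℕ) : ℤ) - cs.length v)) =
          qHalf 2 * qHalf (2 * ((cs.length y : ℤ) - cs.length v)) := by
        rw [qHalf_mul]; push_cast; ring_nf
      have e3 : qHalf (-2) * qHalf 2 = 1 := by rw [qHalf_mul]; exact qHalf_zero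
      rw [e1, e2]
      generalize qHalf (2 * ((cs.length y : ℤ) - cs.length v)) = z at *
      linear_combination (-1) ^ (cs.length y + cs.length v) * z * (incl (r y)) * e3

theorem exists_isRFamily (w : W) : ∃ r, IsRFamily cs w r := by
  induction hn : cs.length w generalizing w with
  | zero => exact ⟨_, cs.length_eq_zero_iff.mp hn ▸ isRFamily_one cs⟩
  | succ n ih =>
    obtain ⟨i, hi⟩ := cs.exists_leftDescent_of_ne_one (w := w) (by rintro rfl; simp at hn)
    rw [CoxeterSystem.isLeftDescent_iff] at hi
    obtain ⟨r, hr⟩ := ih (cs.simple i * w) (by omega)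
    have h := isRFamily_rStep cs (i := i)
      (by rw [CoxeterSystem.simple_mul_simple_cancel_left]; omega) hr
    rw [CoxeterSystem.simple_mul_simple_cancel_left] at h
    exact ⟨_, h⟩

theorem isRPolynomials_of_isRFamily {r : W → W → ℤ[X]}
    (hr : ∀ w, IsRFamily cs w fun y => r y w) : IsRPolynomials cs r where
  zero y w h := (hr w).zero y h
  inv_eq w := by
    rw [← bar_T, (hr w).bar_eq, finsum_bruhatLE cs _ subset_rfl]
    · rfl
    · intro y hy
      simp [(hr w).zero y hy]

/-- The polynomials `R_{y,w}` exist. -/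
theorem isRPolynomials_R : IsRPolynomials cs (R cs) := by
  choose r hr using exists_isRFamily cs
  exact Classical.epsilon_spec ⟨fun y w => r w y, isRPolynomials_of_isRFamily cs hr⟩

end KazhdanLusztig

/-! ### Kazhdan–Lusztig polynomials and their inverses -/

namespace KazhdanLusztig

theorem coeff_incl (p : ℤ[X]) (m : ℤ) :
    (incl p).coeff m = if 0 ≤ m ∧ m % 2 = 0 then p.coeff (m / 2).toNat else 0 := by
  induction p using Polynomial.induction_on' with
  | add p q hp hq =>
    rw [map_add, AddMonoidAlgebra.coeff_add, Finsupp.add_apply, hp, hq]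
    split_ifs <;> simp
  | monomial n a =>
    rw [incl_monomial, qHalf, ← LaurentPolynomial.single_eq_C_mul_T, AddMonoidAlgebra.coeff_single,
      Finsupp.single_apply, coeff_monomial]
    have : (2 * (n : ℤ) = m) ↔ (0 ≤ m ∧ m % 2 = 0) ∧ n = (m / 2).toNat := by omega
    rw [if_congr this rfl rfl]
    split_ifs <;> simp_all

theorem coeff_barA (a : A) (m : ℤ) : (barA a).coeff m = a.coeff (-m) :=
  LaurentPolynomial.invert_apply a m

theorem coeff_qHalf_mul (n : ℤ) (a : A) (m : ℤ) : (qHalf n * a).coeff m = a.coeff (m - n) := by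
  rw [qHalf, LaurentPolynomial.T, AddMonoidAlgebra.coeff_single_mul_apply]
  simp [sub_eq_neg_add]

/-- The part of a polynomial of degree less than `n / 2`. -/
def lowPart (n : ℕ) (p : ℤ[X]) : ℤ[X] :=
  ∑ k ∈ (Finset.range n).filter (2 * · < n), monomial k (p.coeff k)

theorem coeff_lowPart (n : ℕ) (p : ℤ[X]) (k : ℕ) :
    (lowPart n p).coeff k = if 2 * k < n then p.coeff k else 0 := by
  simp only [lowPart, finsetSum_coeff, coeff_monomial, Finset.sum_ite_eq', Finset.mem_filter,
    Finset.mem_range]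
  refine if_congr ?_ rfl rfl
  omega

theorem natDegree_lowPart {n : ℕ} (hn : 0 < n) (p : ℤ[X]) :
    2 * (lowPart n p).natDegree + 1 ≤ n := by
  by_contra h
  have h0 : lowPart n p = 0 := by
    rw [← leadingCoeff_eq_zero, leadingCoeff, coeff_lowPart, if_neg (by omega)]
  rw [h0, natDegree_zero] at h
  omega

/-- A polynomial with `q^n \overline F = -F` is of the form `q^n \overline P - P` for a polynomial
`P` of degree less than `n / 2`, namely for minus its own part in these degrees; the coefficient
in degree `n / 2` vanishes. -/
theorem qHalf_mul_barA_neg_lowPart {n : ℕ} {p : ℤ[X]}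
    (hp : qHalf (2 * n) * barA (incl p) = -incl p) :
    qHalf (2 * n) * barA (incl (-lowPart n p)) = incl p + incl (-lowPart n p) := by
  have hc (m : ℤ) : (incl p).coeff (2 * n - m) = -(incl p).coeff m := by
    rw [← Finsupp.neg_apply, ← AddMonoidAlgebra.coeff_neg, ← hp, coeff_qHalf_mul, coeff_barA,
      neg_sub]
  have hl (m : ℤ) : (incl (-lowPart n p)).coeff m = if m < n then -(incl p).coeff m else 0 := by
    rw [coeff_incl, coeff_incl, coeff_neg, coeff_lowPart]
    have : 0 ≤ m ∧ m % 2 = 0 → (2 * (m / 2).toNat < n ↔ m < n) := by omega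
    split_ifs <;> simp_all
  refine LaurentPolynomial.ext fun m => ?_
  rw [AddMonoidAlgebra.coeff_add, Finsupp.add_apply, coeff_qHalf_mul, coeff_barA, neg_sub, hl, hl,
    hc, neg_neg]
  rcases lt_trichotomy m n with h | h | h
  · rw [if_neg (by omega), if_pos h, add_neg_cancel]
  · have := hc n
    rw [show (2 * n - n : ℤ) = n by ring] at this
    rw [h, if_neg (by omega), if_neg (by omega), add_zero]
    omega
  · rw [if_pos (by omega), if_neg (by omega), add_zero]

variable {B W : Type*} [Group W] {M : CoxeterMatrix B} (cs : CoxeterSystem M W)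

theorem bar_T_eq_sum {w : W} {r : W → ℤ[X]} (hr : IsRFamily cs w r) {s : Finset W}
    (hs : lowerSet cs w ⊆ s) :
    bar M (T cs w) = ∑ y ∈ s, rCoeff cs r y • (T cs y : Hecke M) := by
  rw [hr.bar_eq]
  refine Finset.sum_subset hs fun y _ hy => ?_
  rw [mem_lowerSet] at hy
  simp [rCoeff, hr.zero _ hy]

theorem lowerSet_subset {x y : W} (h : BruhatLE cs x y) : lowerSet cs x ⊆ lowerSet cs y := by
  intro z hz
  rw [mem_lowerSet] at hz ⊢
  exact hz.trans h

open Classical in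
/-- The `R`-polynomials satisfy `∑_z q^{|z|-|y|} \overline{R_{y,z}} R_{z,u} = δ_{y,u}`, because the
bar involution is an involution. -/
theorem sum_barA_mul_incl_eq {r : W → W → ℤ[X]} (hr : ∀ w, IsRFamily cs w fun y => r y w)
    {w u y : W} (hu : BruhatLE cs u w) (hy : BruhatLE cs y w) :
    ∑ z ∈ lowerSet cs w,
      qHalf (2 * ((cs.length z : ℤ) - cs.length y)) * barA (incl (r y z)) * incl (r z u) =
      if y = u then 1 else 0 := by
  have h := bar_bar (T cs u : Hecke M)
  rw [bar_T_eq_sum cs (hr u) (lowerSet_subset cs hu), map_sum] at h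
  have h2 : ∀ z ∈ lowerSet cs w, bar M (rCoeff cs (fun y => r y u) z • (T cs z : Hecke M)) =
      ∑ y ∈ lowerSet cs w, (barA (rCoeff cs (fun y => r y u) z) *
        rCoeff cs (fun y => r y z) y) • (T cs y : Hecke M) := by
    intro z hz
    rw [bar_smul, bar_T_eq_sum cs (hr z) (lowerSet_subset cs (mem_lowerSet.mp hz)),
      Finset.smul_sum]
    simp only [smul_smul]
  rw [Finset.sum_congr rfl h2, Finset.sum_comm] at h
  simp only [← Finset.sum_smul, ← basisT_apply] at h
  have h3 := congrArg (fun x => (basisT cs).repr x y) h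
  simp only [map_sum, map_smul, Module.Basis.repr_self, Finsupp.smul_single, Finsupp.coe_finsetSum,
    Finset.sum_apply, Finsupp.single_apply, smul_eq_mul, mul_one, Finset.sum_ite_eq',
    mem_lowerSet, if_pos hy] at h3
  rw [if_congr (eq_comm (a := y)) rfl rfl, ← h3]
  refine Finset.sum_congr rfl fun z _ => ?_
  rw [rCoeff, rCoeff, map_mul, barA_barA, barA_qHalf, mul_sub, sub_eq_add_neg, ← qHalf_mul]
  ring_nf

open Classical in
/-- The family `y ↦ P_{y,w}`, computed downwards from `w`: the polynomial `P_{y,w}` is minus the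
part of degree less than `(|w| - |y|) / 2` of `∑_{y < z ≤ w} R_{y,z} P_{z,w}`. -/
def klFamily (r : W → W → ℤ[X]) (w y : W) : ℤ[X] :=
  if y = w then 1
  else if BruhatLE cs y w then
    -lowPart (cs.length w - cs.length y)
      (∑ z ∈ ((lowerSet cs w).filter fun z => cs.length y < cs.length z).attach,
        r y z.1 * klFamily r w z.1)
  else 0
termination_by cs.length w - cs.length y
decreasing_by
  have h := Finset.mem_filter.mp z.2
  have := (mem_lowerSet.mp h.1).length_le
  omega

theorem klFamily_self (r : W → W → ℤ[X]) (w : W) : klFamily cs r w w = 1 := by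
  rw [klFamily, if_pos rfl]

theorem klFamily_of_not_le (r : W → W → ℤ[X]) {w y : W} (h : ¬ BruhatLE cs y w) :
    klFamily cs r w y = 0 := by
  rw [klFamily, if_neg (by rintro rfl; exact h (BruhatLE.refl _)), if_neg h]

theorem klFamily_of_lt (r : W → W → ℤ[X]) {w y : W} (h : BruhatLE cs y w) (hne : y ≠ w) :
    klFamily cs r w y = -lowPart (cs.length w - cs.length y)
      (∑ z ∈ (lowerSet cs w).filter (fun z => cs.length y < cs.length z),
        r y z * klFamily cs r w z) := by
  rw [klFamily, if_neg hne, if_pos h]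
  congr 2
  exact Finset.sum_attach _ fun z => r y z * klFamily cs r w z

theorem IsRFamily.eq_zero_of_length_le {r : W → W → ℤ[X]}
    (hr : ∀ w, IsRFamily cs w fun y => r y w) {y z : W}
    (h : cs.length z ≤ cs.length y) (hne : z ≠ y) : r y z = 0 :=
  (hr z).zero y fun hle => absurd (hle.length_lt hne.symm) (not_lt.mpr h)

theorem sum_eq_add_sum_filter_length_lt {E : Type*} [AddCommMonoid E] {s : Finset W} {y : W}
    (hy : y ∈ s) (f : W → E) (hf : ∀ z, cs.length z ≤ cs.length y → z ≠ y → f z = 0) :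
    ∑ z ∈ s, f z = ∑ z ∈ s.filter (fun z => cs.length y < cs.length z), f z + f y := by
  rw [← Finset.sum_filter_add_sum_filter_not s (fun z => cs.length y < cs.length z)]
  congr 1
  refine Finset.sum_eq_single_of_mem y (by simp [hy]) fun z hz hne => hf z ?_ hne
  simpa using (Finset.mem_filter.mp hz).2

/-- The Kazhdan–Lusztig identity `q^{|w|-|y|} \overline{P_{y,w}} = ∑_z R_{y,z} P_{z,w}`. -/
theorem qHalf_mul_barA_klFamily {r : W → W → ℤ[X]} (hr : ∀ w, IsRFamily cs w fun y => r y w)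
    {w y : W} (hy : BruhatLE cs y w) :
    qHalf (2 * ((cs.length w : ℤ) - cs.length y)) * barA (incl (klFamily cs r w y)) =
      ∑ z ∈ lowerSet cs w, incl (r y z) * incl (klFamily cs r w z) := by
  classical
  induction hn : cs.length w - cs.length y using Nat.strong_induction_on generalizing y with
  | _ n ih =>
    rw [sum_eq_add_sum_filter_length_lt cs (mem_lowerSet.mpr hy) _ fun z h1 h2 => by
      rw [IsRFamily.eq_zero_of_length_le cs hr h1 h2, map_zero, zero_mul]]
    rw [(hr y).self, map_one, one_mul]
    by_cases hyw : y = w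
    · subst hyw
      have : (lowerSet cs y).filter (fun z => cs.length y < cs.length z) = ∅ := by
        refine Finset.filter_eq_empty_iff.mpr fun z hz => ?_
        exact not_lt.mpr (mem_lowerSet.mp hz).length_le
      simp [this, klFamily_self, qHalf_zero]
    set F : ℤ[X] := ∑ z ∈ (lowerSet cs w).filter (fun z => cs.length y < cs.length z),
      r y z * klFamily cs r w z with hF
    have hFi : incl F = ∑ z ∈ (lowerSet cs w).filter (fun z => cs.length y < cs.length z),
        incl (r y z) * incl (klFamily cs r w z) := by
      simp [hF]
    have hlt := hy.length_lt hyw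
    have hnc : (cs.length w : ℤ) - cs.length y = n := by omega
    -- The antisymmetry of `F` follows from the identity for larger elements.
    have hanti : qHalf (2 * n) * barA (incl F) = -incl F := by
      have h1 : ∀ z ∈ (lowerSet cs w).filter (fun z => cs.length y < cs.length z),
          qHalf (2 * n) * barA (incl (r y z) * incl (klFamily cs r w z)) =
          ∑ u ∈ lowerSet cs w, qHalf (2 * ((cs.length z : ℤ) - cs.length y)) *
            barA (incl (r y z)) * incl (r z u) * incl (klFamily cs r w u) := by
        intro z hz
        obtain ⟨hz, hyz⟩ := Finset.mem_filter.mp hz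
        rw [mem_lowerSet] at hz
        have hzw := hz.length_le
        have h2 := ih _ (by omega) hz rfl
        simp only [mul_assoc]
        rw [← Finset.mul_sum, ← Finset.mul_sum, ← h2, map_mul, ← hnc,
          show 2 * ((cs.length w : ℤ) - cs.length y) = 2 * ((cs.length z : ℤ) - cs.length y) +
            2 * ((cs.length w : ℤ) - cs.length z) by ring, ← qHalf_mul]
        ring
      rw [hFi, map_sum, Finset.mul_sum, Finset.sum_congr rfl h1, Finset.sum_comm]
      have h3 : ∀ u ∈ lowerSet cs w,
          ∑ z ∈ (lowerSet cs w).filter (fun z => cs.length y < cs.length z),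
            qHalf (2 * ((cs.length z : ℤ) - cs.length y)) *
            barA (incl (r y z)) * incl (r z u) * incl (klFamily cs r w u) =
          (if y = u then incl (klFamily cs r w u) else 0) -
            incl (r y u) * incl (klFamily cs r w u) := by
        intro u hu
        have h4 := sum_barA_mul_incl_eq cs hr (mem_lowerSet.mp hu) hy
        rw [sum_eq_add_sum_filter_length_lt cs (mem_lowerSet.mpr hy) _ fun z h1 h2 => by
          rw [IsRFamily.eq_zero_of_length_le cs hr h1 h2, map_zero, map_zero, mul_zero, zero_mul],
          sub_self, mul_zero, qHalf_zero, (hr y).self, map_one, map_one, one_mul, one_mul] at h4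
        rw [← Finset.sum_mul, eq_sub_of_add_eq h4]
        split_ifs <;> ring
      rw [Finset.sum_congr rfl h3, Finset.sum_sub_distrib, Finset.sum_ite_eq,
        if_pos (mem_lowerSet.mpr hy),
        sum_eq_add_sum_filter_length_lt cs (mem_lowerSet.mpr hy) _ fun z h1 h2 => by
          rw [IsRFamily.eq_zero_of_length_le cs hr h1 h2, map_zero, zero_mul],
        (hr y).self, map_one, one_mul]
      ring
    have hk := klFamily_of_lt cs r hy hyw
    rw [← hF, hn] at hk
    rw [← hFi, hk, hnc]
    exact qHalf_mul_barA_neg_lowPart hanti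

theorem cElement_eq_sum {p : W → W → ℤ[X]} {w : W} {s : Finset W} (hs : lowerSet cs w ⊆ s)
    (hp : ∀ y, ¬ BruhatLE cs y w → p y w = 0) :
    cElement cs p w = ∑ y ∈ s, ((-1) ^ (cs.length y + cs.length w) *
      qHalf ((cs.length w : ℤ) - 2 * (cs.length y : ℤ)) * barA (incl (p y w))) •
        (T cs y : Hecke M) := by
  rw [cElement, finsum_bruhatLE cs _ hs]
  intro y hy
  simp [hp y hy]

theorem cElement'_eq_sum {p : W → W → ℤ[X]} {w : W} {s : Finset W} (hs : lowerSet cs w ⊆ s)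
    (hp : ∀ y, ¬ BruhatLE cs y w → p y w = 0) :
    cElement' cs p w = ∑ y ∈ s, (qHalf (-(cs.length w : ℤ)) * incl (p y w)) •
        (T cs y : Hecke M) := by
  rw [cElement', finsum_bruhatLE cs _ hs]
  intro y hy
  simp [hp y hy]

theorem isKLPolynomials_klFamily {r : W → W → ℤ[X]} (hr : ∀ w, IsRFamily cs w fun y => r y w) :
    IsKLPolynomials cs fun y w => klFamily cs r w y where
  self w := klFamily_self cs r w
  zero y w h := klFamily_of_not_le cs r h
  degree y w h hne := by
    have := natDegree_lowPart (n := cs.length w - cs.length y)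
      (by have := h.length_lt hne; omega)
      (∑ z ∈ (lowerSet cs w).filter (fun z => cs.length y < cs.length z),
        r y z * klFamily cs r w z)
    rw [klFamily_of_lt cs r h hne, natDegree_neg]
    omega
  bar_eq w := by
    rw [cElement_eq_sum cs (p := fun y w => klFamily cs r w y) subset_rfl
      fun y hy => klFamily_of_not_le cs r hy, map_sum]
    have h2 : ∀ z ∈ lowerSet cs w, bar M (((-1) ^ (cs.length z + cs.length w) *
        qHalf ((cs.length w : ℤ) - 2 * (cs.length z : ℤ)) *
          barA (incl (klFamily cs r w z))) • (T cs z : Hecke M)) =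
        ∑ y ∈ lowerSet cs w, ((-1) ^ (cs.length y + cs.length w) * qHalf (-cs.length w) *
          (incl (r y z) * incl (klFamily cs r w z))) • (T cs y : Hecke M) := by
      intro z hz
      rw [bar_smul, bar_T_eq_sum cs (hr z) (lowerSet_subset cs (mem_lowerSet.mp hz)),
        Finset.smul_sum]
      refine Finset.sum_congr rfl fun y _ => ?_
      rw [smul_smul, rCoeff, (hr z).barA_eq, map_mul, map_mul, barA_barA, barA_qHalf, map_pow,
        map_neg, map_one, show -(cs.length w : ℤ) = -((cs.length w : ℤ) - 2 * cs.length z) +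
          2 * ((cs.length y : ℤ) - cs.length z) + -2 * cs.length y by ring, ← qHalf_mul,
        ← qHalf_mul]
      have hs : (-1 : A) ^ cs.length z * (-1) ^ cs.length z = 1 := by
        rw [← mul_pow]; simp
      congr 1
      simp only [pow_add]
      generalize qHalf (-((cs.length w : ℤ) - 2 * cs.length z)) = a
      generalize qHalf (2 * ((cs.length y : ℤ) - cs.length z)) = b
      generalize qHalf (-2 * cs.length y) = c
      linear_combination (-1) ^ cs.length w * (-1) ^ cs.length y * a * b * c * incl (r y z) *
        incl (klFamily cs r w z) * hs
    rw [Finset.sum_congr rfl h2, Finset.sum_comm]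
    refine Finset.sum_congr rfl fun y hy => ?_
    rw [← Finset.sum_smul, ← Finset.mul_sum, ← qHalf_mul_barA_klFamily cs hr (mem_lowerSet.mp hy),
      mul_assoc, ← mul_assoc (qHalf _) (qHalf _), qHalf_mul, ← mul_assoc]
    congr 4
    ring

/-- The Kazhdan–Lusztig polynomials exist. -/
theorem isKLPolynomials_P : IsKLPolynomials cs (P cs) := by
  choose r hr using exists_isRFamily cs
  exact Classical.epsilon_spec ⟨_, isKLPolynomials_klFamily cs (r := fun y w => r w y) hr⟩

open Classical in
/-- The family `w ↦ Q_{y,w}`, computed upwards from `y` by solving the defining equation for its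
last term. -/
def inverseKLFamily (y w : W) : ℤ[X] :=
  if BruhatLE cs y w then
    (-1) ^ (cs.length y + cs.length w) * ((if y = w then 1 else 0) -
      ∑ z ∈ ((lowerSet cs w).erase w).attach,
        (-1) ^ (cs.length y + cs.length z.1) * inverseKLFamily y z.1 * P cs z.1 w)
  else 0
termination_by cs.length w
decreasing_by
  have h := Finset.mem_erase.mp z.2
  exact (mem_lowerSet.mp h.2).length_lt h.1

theorem isInverseKLPolynomials_inverseKLFamily :
    IsInverseKLPolynomials cs (inverseKLFamily cs) where
  zero y w h := by rw [inverseKLFamily, if_neg h]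
  sum_eq y w h := by
    classical
    have hz (z : W) (hz : ¬ BruhatLE cs y z) : inverseKLFamily cs y z = 0 := by
      rw [inverseKLFamily, if_neg hz]
    rw [finsum_cond_eq_sum_of_cond_iff (t := lowerSet cs w) _ (fun {z} hne => by
      rw [mem_lowerSet]
      refine ⟨And.right, fun h => ⟨?_, h⟩⟩
      by_contra hn
      simp [hz z hn] at hne), ← Finset.add_sum_erase _ _ (mem_lowerSet.mpr (BruhatLE.refl w)),
      (isKLPolynomials_P cs).self, mul_one]
    conv_lhs => enter [1, 2]; rw [inverseKLFamily, if_pos h]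
    rw [← mul_assoc, ← mul_pow, Finset.sum_attach _ fun z =>
      (-1) ^ (cs.length y + cs.length z) * inverseKLFamily cs y z * P cs z w]
    simp

/-- The inverse Kazhdan–Lusztig polynomials exist. -/
theorem isInverseKLPolynomials_Q : IsInverseKLPolynomials cs (Q cs) :=
  Classical.epsilon_spec ⟨_, isInverseKLPolynomials_inverseKLFamily cs⟩

end KazhdanLusztig

/-! ### The two Kazhdan–Lusztig bases and the transition matrix -/

namespace KazhdanLusztig

variable {B W : Type*} [Group W] {M : CoxeterMatrix B} (cs : CoxeterSystem M W)

/-- A family that is triangular with respect to the standard basis and the Bruhat order, with units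
on the diagonal, is a basis. -/
theorem exists_basis_of_triangular {c : W → Hecke M} (a : W → W → A)
    (hc : ∀ w, c w = ∑ y ∈ lowerSet cs w, a y w • (T cs y : Hecke M))
    (ha : ∀ w, IsUnit (a w w)) :
    ∃ b : Module.Basis W A (Hecke M), ∀ w, b w = c w := by
  classical
  have hrepr (w y : W) : (basisT cs).repr (c w) y = if y ∈ lowerSet cs w then a y w else 0 := by
    rw [hc]
    simp only [← basisT_apply, map_sum, map_smul, Module.Basis.repr_self, Finsupp.smul_single,
      smul_eq_mul, mul_one, Finsupp.coe_finsetSum, Finset.sum_apply, Finsupp.single_apply,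
      Finset.sum_ite_eq']
  have hli : LinearIndependent A c := by
    rw [linearIndependent_iff]
    intro l hl
    by_contra hne
    -- A longest element of the support contributes alone to its own coefficient.
    obtain ⟨w, hw, hmax⟩ := l.support.exists_max_image cs.length
      (Finsupp.support_nonempty_iff.mpr hne)
    have h := congrArg (fun x => (basisT cs).repr x w) hl
    simp only [Finsupp.linearCombination_apply, Finsupp.sum, map_sum, map_smul, map_zero,
      Finsupp.coe_finsetSum, Finset.sum_apply, Finsupp.smul_apply, Finsupp.zero_apply, hrepr] at h
    rw [Finset.sum_eq_single_of_mem w hw, if_pos (mem_lowerSet.mpr (BruhatLE.refl w)),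
      smul_eq_mul, (ha w).mul_left_eq_zero] at h
    · exact Finsupp.mem_support_iff.mp hw h
    · intro z hz hzw
      rw [if_neg, smul_zero]
      intro hle
      exact absurd ((mem_lowerSet.mp hle).length_lt hzw.symm) (not_lt.mpr (hmax z hz))
  have hspan : ⊤ ≤ Submodule.span A (Set.range c) := by
    rw [← span_T cs, Submodule.span_le]
    rintro _ ⟨w, rfl⟩
    induction hn : cs.length w using Nat.strong_induction_on generalizing w with
    | _ n ih =>
      have h := hc w
      rw [← Finset.add_sum_erase _ _ (mem_lowerSet.mpr (BruhatLE.refl w)), ← sub_eq_iff_eq_add] at h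
      obtain ⟨u, hu⟩ := ha w
      have hT : (T cs w : Hecke M) = (↑u⁻¹ : A) • (c w -
          ∑ y ∈ (lowerSet cs w).erase w, a y w • (T cs y : Hecke M)) := by
        rw [h, ← hu, smul_smul, Units.inv_mul, one_smul]
      rw [SetLike.mem_coe]
      simp only [hT]
      refine Submodule.smul_mem _ _ (sub_mem (Submodule.subset_span ⟨w, rfl⟩)
        (Submodule.sum_mem _ fun y hy => Submodule.smul_mem _ _ ?_))
      have hy' := Finset.mem_erase.mp hy
      exact ih _ (hn ▸ (mem_lowerSet.mp hy'.2).length_lt hy'.1) y rfl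
  exact ⟨Module.Basis.mk hli hspan, fun w => Module.Basis.mk_apply hli hspan w⟩

theorem isUnit_qHalf (n : ℤ) : IsUnit (qHalf n) := LaurentPolynomial.isUnit_T n

theorem C_eq_sum {w : W} {s : Finset W} (hs : lowerSet cs w ⊆ s) :
    C cs w = ∑ y ∈ s, ((-1) ^ (cs.length y + cs.length w) *
      qHalf ((cs.length w : ℤ) - 2 * (cs.length y : ℤ)) * barA (incl (P cs y w))) •
        (T cs y : Hecke M) :=
  cElement_eq_sum cs hs fun y hy => (isKLPolynomials_P cs).zero y w hy

theorem C'_eq_sum {w : W} {s : Finset W} (hs : lowerSet cs w ⊆ s) :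
    C' cs w = ∑ y ∈ s, (qHalf (-(cs.length w : ℤ)) * incl (P cs y w)) • (T cs y : Hecke M) :=
  cElement'_eq_sum cs hs fun y hy => (isKLPolynomials_P cs).zero y w hy

theorem exists_basis_C : ∃ b : Module.Basis W A (Hecke M), ∀ w, b w = C cs w := by
  refine exists_basis_of_triangular cs _ (fun w => C_eq_sum cs subset_rfl) fun w => ?_
  rw [(isKLPolynomials_P cs).self, map_one, map_one, mul_one]
  exact ((isUnit_one.neg).pow _).mul (isUnit_qHalf _)

theorem exists_basis_C' : ∃ b : Module.Basis W A (Hecke M), ∀ w, b w = C' cs w := by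
  refine exists_basis_of_triangular cs _ (fun w => C'_eq_sum cs subset_rfl) fun w => ?_
  rw [(isKLPolynomials_P cs).self, map_one, mul_one]
  exact isUnit_qHalf _

open Classical in
/-- The equation that defines the inverse Kazhdan–Lusztig polynomials, with the sum extended to a
fixed lower set and the condition `y ≤ w` removed. -/
theorem sum_Q_mul_P {x y w : W} (hw : BruhatLE cs w x) :
    ∑ z ∈ lowerSet cs x, (-1) ^ (cs.length y + cs.length z) * Q cs y z * P cs z w =
      if y = w then 1 else 0 := by
  have hQ := isInverseKLPolynomials_Q cs
  have hP := isKLPolynomials_P cs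
  by_cases hyw : BruhatLE cs y w
  · rw [← hQ.sum_eq y w hyw]
    refine (finsum_cond_eq_sum_of_cond_iff _ fun {z} hne => ?_).symm
    have h1 : BruhatLE cs y z := by
      by_contra hn
      simp [hQ.zero y z hn] at hne
    have h2 : BruhatLE cs z w := by
      by_contra hn
      simp [hP.zero z w hn] at hne
    exact ⟨fun _ => mem_lowerSet.mpr (h2.trans hw), fun _ => ⟨h1, h2⟩⟩
  · rw [if_neg (by rintro rfl; exact hyw (BruhatLE.refl _))]
    refine Finset.sum_eq_zero fun z _ => ?_
    by_cases h1 : BruhatLE cs y z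
    · rw [hP.zero z w fun h2 => hyw (h1.trans h2), mul_zero]
    · rw [hQ.zero y z h1, mul_zero, zero_mul]

open Classical in
/-- The matrix of inverse Kazhdan–Lusztig polynomials is also a right inverse. -/
theorem sum_P_mul_Q {x u w : W} (hu : BruhatLE cs u x) (hw : BruhatLE cs w x) :
    ∑ z ∈ lowerSet cs x, P cs u z * ((-1) ^ (cs.length z + cs.length w) * Q cs z w) =
      if u = w then 1 else 0 := by
  let m : Matrix (lowerSet cs x) (lowerSet cs x) ℤ[X] := fun y z =>
    (-1) ^ (cs.length y.1 + cs.length z.1) * Q cs y.1 z.1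
  let n : Matrix (lowerSet cs x) (lowerSet cs x) ℤ[X] := fun y z => P cs y.1 z.1
  have h : m * n = 1 := by
    ext1 y z
    rw [Matrix.mul_apply, Matrix.one_apply,
      Finset.sum_coe_sort (lowerSet cs x) fun v =>
        (-1) ^ (cs.length y.1 + cs.length v) * Q cs y.1 v * P cs v z.1,
      sum_Q_mul_P cs (mem_lowerSet.mp z.2)]
    exact if_congr Subtype.ext_iff.symm rfl rfl
  have h1 : n * m = 1 := mul_eq_one_comm.mp h
  have h2 := congrFun (congrFun h1 ⟨u, mem_lowerSet.mpr hu⟩)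
    ⟨w, mem_lowerSet.mpr hw⟩
  rw [Matrix.mul_apply, Matrix.one_apply, Finset.sum_coe_sort (lowerSet cs x) fun v =>
    P cs u v * ((-1) ^ (cs.length v + cs.length w) * Q cs v w)] at h2
  simpa using h2

/-- The expansion of `C_w = \overline{C_w}` in the elements `\overline{T_u}`. -/
theorem C_eq_sum_bar_T {w : W} {s : Finset W} (hs : lowerSet cs w ⊆ s) :
    C cs w = ∑ u ∈ s, ((-1) ^ (cs.length u + cs.length w) *
      qHalf (2 * (cs.length u : ℤ) - cs.length w) * incl (P cs u w)) • bar M (T cs u) := by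
  rw [← show bar M (C cs w) = C cs w from (isKLPolynomials_P cs).bar_eq w, C_eq_sum cs hs, map_sum]
  refine Finset.sum_congr rfl fun u _ => ?_
  rw [bar_smul, map_mul, map_mul, barA_barA, barA_qHalf, neg_sub, map_pow, map_neg, map_one]

/-- Inverting the expansion of the `C_y` in the `\overline{T_u}`:
`∑_y q^{|y|/2} Q_{y,a} C_y = q^{|a|} \overline{T_a}`. -/
theorem sum_Q_smul_C {x a : W} (ha : BruhatLE cs a x) :
    ∑ y ∈ lowerSet cs x, (qHalf (cs.length y) * incl (Q cs y a)) • C cs y =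
      qHalf (2 * cs.length a) • bar M (T cs a) := by
  classical
  have h1 : ∀ y ∈ lowerSet cs x, (qHalf (cs.length y) * incl (Q cs y a)) • C cs y =
      ∑ u ∈ lowerSet cs x, (qHalf (2 * cs.length u) * (-1) ^ (cs.length u + cs.length a) *
        incl (P cs u y * ((-1) ^ (cs.length y + cs.length a) * Q cs y a))) • bar M (T cs u) := by
    intro y hy
    rw [C_eq_sum_bar_T cs (lowerSet_subset cs (mem_lowerSet.mp hy)), Finset.smul_sum]
    refine Finset.sum_congr rfl fun u _ => ?_
    have hs : (-1 : A) ^ cs.length a * (-1) ^ cs.length a = 1 := by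
      rw [← mul_pow]; simp
    rw [smul_smul,
      show (2 * cs.length u : ℤ) = cs.length y + (2 * cs.length u - cs.length y) by ring,
      ← qHalf_mul, map_mul, map_mul, map_pow, map_neg, map_one]
    congr 1
    simp only [pow_add, show (cs.length y : ℤ) +
      (2 * cs.length u - cs.length y) - cs.length y = 2 * cs.length u - cs.length y by ring]
    generalize qHalf (2 * (cs.length u : ℤ) - cs.length y) = b
    linear_combination -(-1) ^ cs.length u * (-1) ^ cs.length y * qHalf (cs.length y) * b *
      incl (P cs u y) * incl (Q cs y a) * hs
  rw [Finset.sum_congr rfl h1, Finset.sum_comm]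
  have h2 : ∀ u ∈ lowerSet cs x, ∑ y ∈ lowerSet cs x,
      (qHalf (2 * cs.length u) * (-1) ^ (cs.length u + cs.length a) *
        incl (P cs u y * ((-1) ^ (cs.length y + cs.length a) * Q cs y a))) • bar M (T cs u) =
      if u = a then qHalf (2 * cs.length u) • bar M (T cs u) else 0 := by
    intro u hu
    rw [← Finset.sum_smul, ← Finset.mul_sum, ← map_sum, sum_P_mul_Q cs (mem_lowerSet.mp hu) ha]
    split_ifs with h
    · rw [h, ← two_mul, pow_mul]; simp
    · simp
  rw [Finset.sum_congr rfl h2, Finset.sum_ite_eq', if_pos (mem_lowerSet.mpr ha)]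

/-- Applying the bar involution to the expansion of `\overline{T_b}` gives
`T_b = ∑_a R_{a,b} q^{|a|} \overline{T_a}`. -/
theorem sum_R_smul_bar_T {x b : W} (hb : BruhatLE cs b x) :
    ∑ a ∈ lowerSet cs x, (incl (R cs a b) * qHalf (2 * cs.length a)) • bar M (T cs a) = T cs b := by
  have hR := isRPolynomials_R cs
  have h := bar_bar (T cs b : Hecke M)
  rw [bar_T, hR.inv_eq, finsum_bruhatLE cs _ (lowerSet_subset cs hb), map_sum] at h
  · rw [← h]
    refine Finset.sum_congr rfl fun a _ => ?_
    rw [bar_smul, map_mul, barA_barA, barA_qHalf]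
    ring_nf
  · intro y hy
    simp [hR.zero y b hy]

theorem Xi_eq_sum (y x : W) : Xi cs y x =
    ∑ b ∈ lowerSet cs x, ∑ a ∈ lowerSet cs x, Q cs y a * R cs a b * P cs b x := by
  have hQ := isInverseKLPolynomials_Q cs
  have hR := isRPolynomials_R cs
  have hP := isKLPolynomials_P cs
  rw [Finset.sum_comm, ← Finset.sum_product', Xi]
  refine finsum_cond_eq_sum_of_cond_iff _ fun {z} hne => ?_
  have h1 : BruhatLE cs y z.1 := by
    by_contra hn
    simp [hQ.zero _ _ hn] at hne
  have h2 : BruhatLE cs z.1 z.2 := by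
    by_contra hn
    simp [hR.zero _ _ hn] at hne
  have h3 : BruhatLE cs z.2 x := by
    by_contra hn
    simp [hP.zero _ _ hn] at hne
  simp [h1, h2, h3, h2.trans h3]

theorem C'_eq_sum_Xi_smul_C (x : W) :
    C' cs x = ∑ y ∈ lowerSet cs x,
      (qHalf ((cs.length y : ℤ) - cs.length x) * incl (Xi cs y x)) • C cs y := by
  rw [C'_eq_sum cs subset_rfl]
  have h1 : ∀ b ∈ lowerSet cs x,
      (qHalf (-(cs.length x : ℤ)) * incl (P cs b x)) • (T cs b : Hecke M) =
        ∑ a ∈ lowerSet cs x, ∑ y ∈ lowerSet cs x, (qHalf ((cs.length y : ℤ) - cs.length x) *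
          incl (Q cs y a * R cs a b * P cs b x)) • C cs y := by
    intro b hb
    rw [← sum_R_smul_bar_T cs (mem_lowerSet.mp hb), Finset.smul_sum]
    refine Finset.sum_congr rfl fun a ha => ?_
    rw [mul_smul (incl _), ← sum_Q_smul_C cs (mem_lowerSet.mp ha), Finset.smul_sum, Finset.smul_sum]
    refine Finset.sum_congr rfl fun y _ => ?_
    rw [smul_smul, smul_smul, sub_eq_add_neg, ← qHalf_mul, map_mul, map_mul]
    congr 1
    ring
  rw [Finset.sum_congr rfl h1]
  simp only [Xi_eq_sum, map_sum, Finset.mul_sum, Finset.sum_smul]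
  rw [Finset.sum_congr rfl fun b _ => Finset.sum_comm, Finset.sum_comm]

end KazhdanLusztig

end

theorem mainTheorem6 {B W : Type*} [Group W] {M : CoxeterMatrix B} (cs : CoxeterSystem M W) :
    (∃ b b' : Module.Basis W KazhdanLusztig.A (KazhdanLusztig.Hecke M),
      (∀ w, b w = KazhdanLusztig.C cs w) ∧ (∀ w, b' w = KazhdanLusztig.C' cs w)) ∧
    (∀ x : W, {y : W | KazhdanLusztig.BruhatLE cs y x}.Finite ∧
      KazhdanLusztig.C' cs x =
        ∑ᶠ (y : W) (_ : KazhdanLusztig.BruhatLE cs y x),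
          (KazhdanLusztig.qHalf ((cs.length y : ℤ) - (cs.length x : ℤ)) *
            KazhdanLusztig.incl (KazhdanLusztig.Xi cs y x)) • KazhdanLusztig.C cs y) := by
  obtain ⟨b, hb⟩ := KazhdanLusztig.exists_basis_C cs
  obtain ⟨b', hb'⟩ := KazhdanLusztig.exists_basis_C' cs
  refine ⟨⟨b, b', hb, hb'⟩, fun x => ⟨KazhdanLusztig.finite_setOf_bruhatLE cs x, ?_⟩⟩
  rw [KazhdanLusztig.C'_eq_sum_Xi_smul_C]
  exact (finsum_cond_eq_sum_of_cond_iff _ fun _ => KazhdanLusztig.mem_lowerSet.symm).symm
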